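/- Identify $\mathbb R^2$ with $\mathbb C$. Let $\Omega\subset\mathbb C$ be a bounded open set with $C^2$ boundary, with outward unit normal $n(s)$ and unit tangent $t(s)=i\,n(s)$ at $s\in\partial\Omega$ (as complex numbers). Let $T=-i(\sigma_1\partial_1+\sigma_2\partial_2)$ be the massless Dirac expression, with Pauli matrices $\sigma_1,\sigma_2,\sigma_3$. For $\eta:\partial\Omega\to\mathbb R$ put $$A_\eta=\cos\eta\,(t_1\sigma_1+t_2\sigma_2)+\sin\eta\,\sigma_3,\qquad t=t_1+it_2,\qquad P_{-,\eta}=\tfrac12(1-A_\eta),$$ and let $D_\eta$ be the operator in $L^2(\Omega,\mathbb C^2)$ acting as $T$ on $$\mathrm{Dom}(D_\eta)=\{u\in H^1(\Omega,\mathbb C^2)\;:\;P_{-,\eta}\gamma u=0\},$$ where $\gamma$ is the boundary trace operator. Let $s_0\in\partial\Omega$, let $\eta$ be of class $C^1$ on a neighbourhood of $s_0$ in $\partial\Omega$, and suppose that $\cos\eta$ vanishes at least quadratically at $s_0$: $|\cos\eta(s)|\le C|s-s_0|^2$ for $s\in\partial\Omega$ near $s_0$. A singular Weyl sequence of an operator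 $A$ at $0$ is a sequence $w_n\in\mathrm{Dom}(A)$ with $\|w_n\|=1$, $w_n\rightharpoonup0$ weakly and $\|Aw_n\|\to0$. The essential spectrum of $A$ is the set of $\lambda\in\mathbb C$ for which $A-\lambda$ is not Fredholm. A self-adjoint realisation of $D_\eta$ is a self-adjoint extension of $D_\eta$ in $L^2(\Omega,\mathbb C^2)$. (1) Suppose that $\sin\eta(s_0)=1$ (i.e. $\eta$ tends to $\pi/2$ modulo $2\pi$ at $s_0$). Then there are $R_0>0$ and $C^1$ functions $B:\mathbb C\to\mathbb R$ and $\tilde t:\mathbb C\to\mathbb C$ such that, at all points of $\partial\Omega$ at distance less than $R_0$ from $s_0$, one has $1+\sin\eta>0$, $B=\frac{\cos\eta}{1+\sin\eta}$ (which equals $\frac{1-\sin\eta}{\cos\eta}$ where $\cos\eta\ne0$) and $\tilde t=t$, and such that the following holds. For every $\chi\in C^\infty(\mathbb R,[0,1])$ with $\chi(x)=1$ for $x\le\frac12$ and $\chi(x)=0$ for $x\ge1$ there are $R_n\in(0,R_0]$ and $\varepsilon_n>0$ $(n\ge1)$ such that, with $s_n=s_0+\varepsilon_n\,n(s_0)$,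 the functions $$v_n(z)=\chi\!\left(\frac{|z-s_0|}{R_n}\right)(z-s_n)^{-n}\begin{pmatrix}1\\ B(z)\,\tilde t(z)\end{pmatrix},\qquad z\in\Omega,$$ are nonzero elements of $\mathrm{Dom}(D_\eta)$ with $\|D_\eta v_n\|\le\frac1n\|v_n\|$, and $v_n/\|v_n\|$ is a singular Weyl sequence of $D_\eta$ at $0$. (2) Whatever the value $\sin\eta(s_0)=\pm1$, there is a singular Weyl sequence of $D_\eta$ at $0$ (in particular, contained in $\mathrm{Dom}(D_\eta)\subset H^1(\Omega,\mathbb C^2)$). (3) $0$ lies in the essential spectrum of every self-adjoint realisation of $D_\eta$, and no self-adjoint realisation of $D_\eta$ has its domain contained in $H^1(\Omega,\mathbb C^2)$. -/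

import Mathlib

open MeasureTheory Set Filter Topology Asymptotics
open scoped ENNReal ContDiff InnerProductSpace

noncomputable section

namespace DiracBilliard

/-! ### Planar domains with `C²` boundary; `ℝ²` is identified with `ℂ` -/

/-- `ν` is the outward unit normal of `Ω` at `p`, and near `p` the boundary is a `C²` graph over
its tangent line: in the coordinates `z = p + ν (x + i y)` the set `Ω` is, near `p`, the region
`x < h y` with `h` of class `C²` and `h 0 = h' 0 = 0`. -/
def IsOutwardNormal (Ω : Set ℂ) (p ν : ℂ) : Prop :=
  ‖ν‖ = 1 ∧ ∃ (h : ℝ → ℝ) (r : ℝ), 0 < r ∧ ContDiff ℝ 2 h ∧ h 0 = 0 ∧ deriv h 0 = 0 ∧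
    ∀ z ∈ Metric.ball p r,
      (z ∈ Ω ↔ ((z - p) * starRingEnd ℂ ν).re < h ((z - p) * starRingEnd ℂ ν).im)

/-- The boundary of `Ω` is of class `C²`. -/
def HasC2Boundary (Ω : Set ℂ) : Prop :=
  ∀ p ∈ frontier Ω, ∃ ν, IsOutwardNormal Ω p ν

open Classical in
/-- The outward unit normal `n(p)` at a boundary point `p`, as a complex number
(`0` where there is none). -/
def outwardNormal (Ω : Set ℂ) (p : ℂ) : ℂ :=
  if h : ∃ ν, IsOutwardNormal Ω p ν then h.choose else 0

/-- The unit tangent `t(p)`, chosen such that `(n, t)` is positively oriented: `t = i n`. -/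
def unitTangent (Ω : Set ℂ) (p : ℂ) : ℂ := Complex.I * outwardNormal Ω p

/-- Arc length on the boundary of `Ω`. -/
def boundaryMeasure (Ω : Set ℂ) : Measure ℂ := (Measure.hausdorffMeasure 1).restrict (frontier Ω)

/-! ### Spinors and Pauli matrices -/

/-- The values `ℂ²`, with the Euclidean norm. -/
abbrev Spinor : Type := EuclideanSpace ℂ (Fin 2)

/-- The Hilbert space `L²(Ω, ℂ²)`. -/
abbrev L2 (Ω : Set ℂ) : Type := Lp Spinor 2 (volume.restrict Ω)

/-- The Pauli matrix `σ₁`. -/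
def pauli1 : Matrix (Fin 2) (Fin 2) ℂ := !![0, 1; 1, 0]
/-- The Pauli matrix `σ₂`. -/
def pauli2 : Matrix (Fin 2) (Fin 2) ℂ := !![0, -Complex.I; Complex.I, 0]
/-- The Pauli matrix `σ₃`. -/
def pauli3 : Matrix (Fin 2) (Fin 2) ℂ := !![1, 0; 0, -1]

/-- `-i (σ₁ p + σ₂ q)`, that is `T u` where `p = ∂₁ u` and `q = ∂₂ u`. -/
def diracSymbol (p q : Spinor) : Spinor :=
  (-Complex.I) • (Matrix.toEuclideanLin pauli1 p + Matrix.toEuclideanLin pauli2 q)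

/-- `A_η = cos η (σ · t) + sin η σ₃` for the tangent vector `t = t₁ + i t₂`. -/
def boundaryMatrix (η : ℝ) (t : ℂ) : Matrix (Fin 2) (Fin 2) ℂ :=
  (Real.cos η : ℂ) • ((t.re : ℂ) • pauli1 + (t.im : ℂ) • pauli2) + (Real.sin η : ℂ) • pauli3

/-- The projection `P_{-,η} = (1 - A_η) / 2`. -/
def projMinus (η : ℝ) (t : ℂ) : Matrix (Fin 2) (Fin 2) ℂ := (1 / 2 : ℂ) • (1 - boundaryMatrix η t)

/-! ### `H¹` and the boundary trace -/

/-- `g ∈ L²` is the weak derivative of `u ∈ L²` in `Ω` in the direction `e`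
(`e = 1` for `∂₁`, `e = i` for `∂₂`). -/
def HasWeakDeriv (Ω : Set ℂ) (e : ℂ) (u g : L2 Ω) : Prop :=
  ∀ φ : ℂ → ℝ, ContDiff ℝ ∞ φ → HasCompactSupport φ → tsupport φ ⊆ Ω →
    ∫ z in Ω, (fderiv ℝ φ z e) • u z = -∫ z in Ω, φ z • g z

/-- `u ∈ H¹(Ω, ℂ²)`. -/
def MemH1 (Ω : Set ℂ) (u : L2 Ω) : Prop :=
  (∃ g, HasWeakDeriv Ω 1 u g) ∧ ∃ g, HasWeakDeriv Ω Complex.I u g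

/-- `g` is the trace on the boundary of `u ∈ H¹(Ω, ℂ²)`. The trace operator is the continuous
extension of the restriction `φ ↦ φ|_{∂Ω}`, `φ ∈ C¹` up to the boundary: there are
`C¹` functions `φₖ` on `ℝ²` with `φₖ → u` in `H¹(Ω)` and `φₖ → g` in `L²(∂Ω)`. -/
def HasTrace (Ω : Set ℂ) (u : L2 Ω) (g : ℂ → Spinor) : Prop :=
  AEStronglyMeasurable g (boundaryMeasure Ω) ∧
  ∃ g₁ g₂ : L2 Ω, HasWeakDeriv Ω 1 u g₁ ∧ HasWeakDeriv Ω Complex.I u g₂ ∧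
  ∃ φ : ℕ → ℂ → Spinor, (∀ k, ContDiff ℝ 1 (φ k)) ∧
    Tendsto (fun k => eLpNorm (fun z => φ k z - u z) 2 (volume.restrict Ω)) atTop (𝓝 0) ∧
    Tendsto (fun k => eLpNorm (fun z => fderiv ℝ (φ k) z 1 - g₁ z) 2 (volume.restrict Ω))
      atTop (𝓝 0) ∧
    Tendsto (fun k => eLpNorm (fun z => fderiv ℝ (φ k) z Complex.I - g₂ z) 2 (volume.restrict Ω))
      atTop (𝓝 0) ∧
    Tendsto (fun k => eLpNorm (fun z => φ k z - g z) 2 (boundaryMeasure Ω)) atTop (𝓝 0)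

/-! ### The Dirac operator `D_η` -/

/-- `u ∈ Dom(D_η)`: `u ∈ H¹(Ω, ℂ²)` and `P_{-,η} γ u = 0` on the boundary. -/
def MemDiracDomain (Ω : Set ℂ) (η : ℂ → ℝ) (u : L2 Ω) : Prop :=
  MemH1 Ω u ∧ ∃ g, HasTrace Ω u g ∧
    ∀ᵐ s ∂(boundaryMeasure Ω), Matrix.toEuclideanLin (projMinus (η s) (unitTangent Ω s)) (g s) = 0

/-- `f = T u = -i (σ₁ ∂₁ u + σ₂ ∂₂ u)` with weak derivatives. -/
def IsDiracImage (Ω : Set ℂ) (u f : L2 Ω) : Prop :=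
  ∃ g₁ g₂ : L2 Ω, HasWeakDeriv Ω 1 u g₁ ∧ HasWeakDeriv Ω Complex.I u g₂ ∧
    ∀ᵐ z ∂(volume.restrict Ω), f z = diracSymbol (g₁ z) (g₂ z)

theorem integrable_smul_L2 {Ω : Set ℂ} {ψ : ℂ → ℝ} (hc : Continuous ψ) (hs : HasCompactSupport ψ)
    (u : L2 Ω) : Integrable (fun z => ψ z • u z) (volume.restrict Ω) := by
  have h2 : MemLp ψ 2 (volume.restrict Ω) := (hc.memLp_of_hasCompactSupport hs).restrict Ω
  exact memLp_one_iff_integrable.1 ((Lp.memLp u).smul h2)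

theorem continuous_dir {φ : ℂ → ℝ} (hφ : ContDiff ℝ ∞ φ) (e : ℂ) :
    Continuous fun z => fderiv ℝ φ z e :=
  (hφ.continuous_fderiv (by simp)).clm_apply continuous_const

theorem HasWeakDeriv.add {Ω : Set ℂ} {e : ℂ} {u g v k : L2 Ω} (h₁ : HasWeakDeriv Ω e u g)
    (h₂ : HasWeakDeriv Ω e v k) : HasWeakDeriv Ω e (u + v) (g + k) := by
  intro φ hφ hc hs
  have hd := continuous_dir hφ e
  have hdc : HasCompactSupport fun z => fderiv ℝ φ z e := hc.fderiv_apply ℝ e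
  have e1 : ∫ z in Ω, (fderiv ℝ φ z e) • (u + v : L2 Ω) z
      = ∫ z in Ω, ((fderiv ℝ φ z e) • u z + (fderiv ℝ φ z e) • v z) := by
    refine integral_congr_ae ?_
    filter_upwards [Lp.coeFn_add u v] with z hz
    rw [hz, Pi.add_apply, smul_add]
  have e2 : ∫ z in Ω, φ z • (g + k : L2 Ω) z = ∫ z in Ω, (φ z • g z + φ z • k z) := by
    refine integral_congr_ae ?_
    filter_upwards [Lp.coeFn_add g k] with z hz
    rw [hz, Pi.add_apply, smul_add]
  rw [e1, e2, integral_add (integrable_smul_L2 hd hdc u) (integrable_smul_L2 hd hdc v),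
    integral_add (integrable_smul_L2 hφ.continuous hc g) (integrable_smul_L2 hφ.continuous hc k),
    h₁ φ hφ hc hs, h₂ φ hφ hc hs]
  abel

theorem HasWeakDeriv.smul {Ω : Set ℂ} {e : ℂ} {u g : L2 Ω} (c : ℂ) (h : HasWeakDeriv Ω e u g) :
    HasWeakDeriv Ω e (c • u) (c • g) := by
  intro φ hφ hc hs
  have e1 : ∫ z in Ω, (fderiv ℝ φ z e) • (c • u : L2 Ω) z
      = ∫ z in Ω, c • ((fderiv ℝ φ z e) • u z) := by
    refine integral_congr_ae ?_
    filter_upwards [Lp.coeFn_smul c u] with z hz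
    rw [hz, Pi.smul_apply, smul_comm]
  have e2 : ∫ z in Ω, φ z • (c • g : L2 Ω) z = ∫ z in Ω, c • (φ z • g z) := by
    refine integral_congr_ae ?_
    filter_upwards [Lp.coeFn_smul c g] with z hz
    rw [hz, Pi.smul_apply, smul_comm]
  rw [e1, e2, integral_smul, integral_smul, h φ hφ hc hs, smul_neg]

/-- Weak derivatives are unique on open sets. -/
theorem HasWeakDeriv.eq_zero {Ω : Set ℂ} (hΩ : IsOpen Ω) {e : ℂ} {g : L2 Ω}
    (h : HasWeakDeriv Ω e 0 g) : g = 0 := by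
  have hint : LocallyIntegrableOn (g : ℂ → Spinor) Ω (volume.restrict Ω) :=
    ((Lp.memLp g).locallyIntegrable (by norm_num)).locallyIntegrableOn Ω
  have key := hΩ.ae_eq_zero_of_integral_contDiff_smul_eq_zero hint (fun φ hφ hc hs => by
    have h1 := h φ hφ hc hs
    have h0 : ∫ z in Ω, (fderiv ℝ φ z e) • (0 : L2 Ω) z = 0 := by
      refine integral_eq_zero_of_ae ?_
      filter_upwards [Lp.coeFn_zero Spinor 2 (volume.restrict Ω)] with z hz
      rw [hz, Pi.zero_apply, smul_zero]
    rw [h0] at h1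
    exact neg_eq_zero.1 h1.symm)
  rw [Lp.eq_zero_iff_ae_eq_zero]
  filter_upwards [key, ae_restrict_mem hΩ.measurableSet] with z hz hm
  exact hz hm

theorem tendsto_eLpNorm_add {μ : Measure ℂ} {a b : ℕ → ℂ → Spinor} {c : ℕ → ℂ → Spinor}
    (ham : ∀ k, AEStronglyMeasurable (a k) μ) (hbm : ∀ k, AEStronglyMeasurable (b k) μ)
    (ha : Tendsto (fun k => eLpNorm (a k) 2 μ) atTop (𝓝 0))
    (hb : Tendsto (fun k => eLpNorm (b k) 2 μ) atTop (𝓝 0))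
    (hc : ∀ k, c k =ᵐ[μ] a k + b k) :
    Tendsto (fun k => eLpNorm (c k) 2 μ) atTop (𝓝 0) := by
  have hab := ha.add hb
  rw [add_zero] at hab
  refine tendsto_of_tendsto_of_tendsto_of_le_of_le tendsto_const_nhds hab (fun _ => zero_le)
    (fun k => ?_)
  rw [eLpNorm_congr_ae (hc k)]
  exact eLpNorm_add_le (ham k) (hbm k) (by norm_num)

theorem tendsto_eLpNorm_smul {μ : Measure ℂ} {a : ℕ → ℂ → Spinor} {c : ℕ → ℂ → Spinor} (r : ℂ)
    (ha : Tendsto (fun k => eLpNorm (a k) 2 μ) atTop (𝓝 0)) (hc : ∀ k, c k =ᵐ[μ] r • a k) :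
    Tendsto (fun k => eLpNorm (c k) 2 μ) atTop (𝓝 0) := by
  have h := ENNReal.Tendsto.const_mul (a := ‖r‖ₑ) ha (Or.inr (by simp))
  rw [mul_zero] at h
  refine h.congr (fun k => ?_)
  rw [eLpNorm_congr_ae (hc k), eLpNorm_const_smul]

theorem ContDiff.aesm_dir {φ : ℂ → Spinor} (hφ : ContDiff ℝ 1 φ) (e : ℂ) (μ : Measure ℂ) :
    AEStronglyMeasurable (fun z => fderiv ℝ φ z e) μ :=
  ((hφ.continuous_fderiv (by simp)).clm_apply continuous_const).aestronglyMeasurable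

theorem HasTrace.add {Ω : Set ℂ} {u v : L2 Ω} {g k : ℂ → Spinor} (h₁ : HasTrace Ω u g)
    (h₂ : HasTrace Ω v k) : HasTrace Ω (u + v) (g + k) := by
  obtain ⟨hg, g₁, g₂, hg₁, hg₂, φ, hφ, a0, a1, a2, a3⟩ := h₁
  obtain ⟨hk, k₁, k₂, hk₁, hk₂, ψ, hψ, b0, b1, b2, b3⟩ := h₂
  have hd : ∀ n z e, fderiv ℝ (φ n + ψ n) z e = fderiv ℝ (φ n) z e + fderiv ℝ (ψ n) z e := by
    intro n z e
    rw [fderiv_add ((hφ n).differentiable (by simp) z) ((hψ n).differentiable (by simp) z)]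
    rfl
  refine ⟨hg.add hk, g₁ + k₁, g₂ + k₂, hg₁.add hk₁, hg₂.add hk₂, fun n => φ n + ψ n,
    fun n => (hφ n).add (hψ n), ?_, ?_, ?_, ?_⟩
  · refine tendsto_eLpNorm_add
      (fun n => (hφ n).continuous.aestronglyMeasurable.sub (Lp.aestronglyMeasurable u))
      (fun n => (hψ n).continuous.aestronglyMeasurable.sub (Lp.aestronglyMeasurable v)) a0 b0
      (fun n => ?_)
    filter_upwards [Lp.coeFn_add u v] with z hz
    simp only [hz, Pi.add_apply, Pi.sub_apply]
    abel
  · refine tendsto_eLpNorm_add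
      (fun n => (ContDiff.aesm_dir (hφ n) 1 _).sub (Lp.aestronglyMeasurable g₁))
      (fun n => (ContDiff.aesm_dir (hψ n) 1 _).sub (Lp.aestronglyMeasurable k₁)) a1 b1
      (fun n => ?_)
    filter_upwards [Lp.coeFn_add g₁ k₁] with z hz
    simp only [hz, hd, Pi.add_apply, Pi.sub_apply]
    abel
  · refine tendsto_eLpNorm_add
      (fun n => (ContDiff.aesm_dir (hφ n) Complex.I _).sub (Lp.aestronglyMeasurable g₂))
      (fun n => (ContDiff.aesm_dir (hψ n) Complex.I _).sub (Lp.aestronglyMeasurable k₂)) a2 b2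
      (fun n => ?_)
    filter_upwards [Lp.coeFn_add g₂ k₂] with z hz
    simp only [hz, hd, Pi.add_apply, Pi.sub_apply]
    abel
  · refine tendsto_eLpNorm_add
      (fun n => (hφ n).continuous.aestronglyMeasurable.sub hg)
      (fun n => (hψ n).continuous.aestronglyMeasurable.sub hk) a3 b3
      (fun n => Eventually.of_forall fun z => ?_)
    simp only [Pi.add_apply, Pi.sub_apply]
    abel

theorem HasTrace.smul {Ω : Set ℂ} {u : L2 Ω} {g : ℂ → Spinor} (c : ℂ) (h : HasTrace Ω u g) :
    HasTrace Ω (c • u) (c • g) := by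
  obtain ⟨hg, g₁, g₂, hg₁, hg₂, φ, hφ, a0, a1, a2, a3⟩ := h
  have hd : ∀ n z e, fderiv ℝ (c • φ n) z e = c • fderiv ℝ (φ n) z e := by
    intro n z e
    rw [fderiv_const_smul ((hφ n).differentiable (by simp) z)]
    rfl
  refine ⟨hg.const_smul c, c • g₁, c • g₂, hg₁.smul c, hg₂.smul c, fun n => c • φ n,
    fun n => (hφ n).const_smul c, ?_, ?_, ?_, ?_⟩
  · refine tendsto_eLpNorm_smul c a0 (fun n => ?_)
    filter_upwards [Lp.coeFn_smul c u] with z hz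
    simp only [hz, Pi.smul_apply, smul_sub]
  · refine tendsto_eLpNorm_smul c a1 (fun n => ?_)
    filter_upwards [Lp.coeFn_smul c g₁] with z hz
    simp only [hz, hd, Pi.smul_apply, smul_sub]
  · refine tendsto_eLpNorm_smul c a2 (fun n => ?_)
    filter_upwards [Lp.coeFn_smul c g₂] with z hz
    simp only [hz, hd, Pi.smul_apply, smul_sub]
  · refine tendsto_eLpNorm_smul c a3 (fun n => Eventually.of_forall fun z => ?_)
    simp only [Pi.smul_apply, smul_sub]

theorem HasWeakDeriv.zero (Ω : Set ℂ) (e : ℂ) : HasWeakDeriv Ω e 0 0 := by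
  intro φ _ _ _
  have h : ∀ ψ : ℂ → ℝ, ∫ z in Ω, ψ z • (0 : L2 Ω) z = 0 := fun ψ => by
    refine integral_eq_zero_of_ae ?_
    filter_upwards [Lp.coeFn_zero Spinor 2 (volume.restrict Ω)] with z hz
    rw [hz, Pi.zero_apply, smul_zero]
  rw [h φ, h fun z => fderiv ℝ φ z e, neg_zero]

theorem HasTrace.zero (Ω : Set ℂ) : HasTrace Ω 0 0 := by
  have h0 : eLpNorm (fun z => (0 : Spinor) - (0 : L2 Ω) z) 2 (volume.restrict Ω) = 0 := by
    have : (fun z => (0 : Spinor) - (0 : L2 Ω) z) =ᵐ[volume.restrict Ω] 0 := by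
      filter_upwards [Lp.coeFn_zero Spinor 2 (volume.restrict Ω)] with z hz
      rw [hz, Pi.zero_apply, sub_zero]
    rw [eLpNorm_congr_ae this, eLpNorm_zero]
  refine ⟨aestronglyMeasurable_zero, 0, 0, HasWeakDeriv.zero Ω 1, HasWeakDeriv.zero Ω Complex.I,
    fun _ _ => 0, fun _ => contDiff_const, ?_, ?_, ?_, ?_⟩
  · simp only [h0, tendsto_const_nhds]
  · simp only [fderiv_const_apply, zero_apply, h0, tendsto_const_nhds]
  · simp only [fderiv_const_apply, zero_apply, h0, tendsto_const_nhds]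
  · simp

/-- The graph of `D_η`: all pairs `(u, T u)` with `u ∈ Dom(D_η)`. -/
def diracGraph (Ω : Set ℂ) (η : ℂ → ℝ) : Submodule ℂ (L2 Ω × L2 Ω) where
  carrier := {p | MemDiracDomain Ω η p.1 ∧ IsDiracImage Ω p.1 p.2}
  zero_mem' := by
    refine ⟨⟨⟨⟨0, HasWeakDeriv.zero Ω _⟩, ⟨0, HasWeakDeriv.zero Ω _⟩⟩, 0, HasTrace.zero Ω, ?_⟩,
      0, 0, HasWeakDeriv.zero Ω _, HasWeakDeriv.zero Ω _, ?_⟩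
    · simp
    · filter_upwards [Lp.coeFn_zero Spinor 2 (volume.restrict Ω)] with z hz
      simp only [hz, diracSymbol, Prod.snd_zero, Pi.zero_apply, map_zero, add_zero, smul_zero]
  add_mem' := by
    rintro ⟨u, f⟩ ⟨v, k⟩ ⟨⟨⟨⟨p₁, hp₁⟩, ⟨p₂, hp₂⟩⟩, g, hg, hg0⟩, g₁, g₂, hg₁, hg₂, hf⟩
      ⟨⟨⟨⟨q₁, hq₁⟩, ⟨q₂, hq₂⟩⟩, l, hl, hl0⟩, k₁, k₂, hk₁, hk₂, hk⟩
    refine ⟨⟨⟨⟨_, hp₁.add hq₁⟩, ⟨_, hp₂.add hq₂⟩⟩, _, hg.add hl, ?_⟩,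
      _, _, hg₁.add hk₁, hg₂.add hk₂, ?_⟩
    · filter_upwards [hg0, hl0] with s h1 h2
      rw [Pi.add_apply, map_add, h1, h2, add_zero]
    · filter_upwards [hf, hk, Lp.coeFn_add f k, Lp.coeFn_add g₁ k₁, Lp.coeFn_add g₂ k₂]
        with z h1 h2 h3 h4 h5
      simp only [Prod.mk_add_mk, h3, h4, h5, Pi.add_apply, h1, h2, diracSymbol, map_add, smul_add]
      abel
  smul_mem' := by
    rintro c ⟨u, f⟩ ⟨⟨⟨⟨p₁, hp₁⟩, ⟨p₂, hp₂⟩⟩, g, hg, hg0⟩, g₁, g₂, hg₁, hg₂, hf⟩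
    refine ⟨⟨⟨⟨_, hp₁.smul c⟩, ⟨_, hp₂.smul c⟩⟩, _, hg.smul c, ?_⟩,
      _, _, hg₁.smul c, hg₂.smul c, ?_⟩
    · filter_upwards [hg0] with s h1
      rw [Pi.smul_apply, map_smul, h1, smul_zero]
    · filter_upwards [hf, Lp.coeFn_smul c f, Lp.coeFn_smul c g₁, Lp.coeFn_smul c g₂]
        with z h1 h3 h4 h5
      simp only [Prod.smul_mk, h3, h4, h5, Pi.smul_apply, h1, diracSymbol, map_smul, smul_add,
        smul_comm c]

/-- The operator `D_η` in `L²(Ω, ℂ²)`, with domain `Dom(D_η)`, acting as `T`. -/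
def diracOp (Ω : Set ℂ) (η : ℂ → ℝ) : L2 Ω →ₗ.[ℂ] L2 Ω := (diracGraph Ω η).toLinearPMap

theorem diracGraph_functional {Ω : Set ℂ} (hΩ : IsOpen Ω) (η : ℂ → ℝ) (x : L2 Ω × L2 Ω)
    (hx : x ∈ diracGraph Ω η) (hx0 : x.1 = 0) : x.2 = 0 := by
  obtain ⟨-, g₁, g₂, h₁, h₂, hf⟩ := hx
  rw [hx0] at h₁ h₂
  rw [h₁.eq_zero hΩ, h₂.eq_zero hΩ] at hf
  rw [Lp.eq_zero_iff_ae_eq_zero]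
  filter_upwards [hf, Lp.coeFn_zero Spinor 2 (volume.restrict Ω)] with z hz h0
  simp only [hz, h0, diracSymbol, Pi.zero_apply, map_zero, add_zero, smul_zero]

/-- On an open set, `D_η u = f` means `u ∈ Dom(D_η)` and `T u = f`. -/
theorem mem_graph_diracOp {Ω : Set ℂ} (hΩ : IsOpen Ω) (η : ℂ → ℝ) (u f : L2 Ω) :
    (u, f) ∈ (diracOp Ω η).graph ↔ MemDiracDomain Ω η u ∧ IsDiracImage Ω u f := by
  rw [diracOp, Submodule.toLinearPMap_graph_eq _ (diracGraph_functional hΩ η)]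
  rfl

/-- The domain of `D_η` is all of `{u ∈ H¹ | P_{-,η} γ u = 0}`. -/
theorem mem_domain_diracOp (Ω : Set ℂ) (η : ℂ → ℝ) (u : L2 Ω) :
    u ∈ (diracOp Ω η).domain ↔ MemDiracDomain Ω η u := by
  rw [diracOp, Submodule.toLinearPMap_domain, Submodule.mem_map]
  constructor
  · rintro ⟨⟨v, f⟩, hv, rfl⟩
    exact hv.1
  · intro hu
    obtain ⟨⟨g₁, h₁⟩, ⟨g₂, h₂⟩⟩ := hu.1
    let S₁ : Spinor →L[ℂ] Spinor := (Matrix.toEuclideanLin pauli1).toContinuousLinearMap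
    let S₂ : Spinor →L[ℂ] Spinor := (Matrix.toEuclideanLin pauli2).toContinuousLinearMap
    refine ⟨(u, (-Complex.I) • (S₁.compLp g₁ + S₂.compLp g₂)), ⟨hu, g₁, g₂, h₁, h₂, ?_⟩, rfl⟩
    filter_upwards [Lp.coeFn_smul (-Complex.I) (S₁.compLp g₁ + S₂.compLp g₂),
      Lp.coeFn_add (S₁.compLp g₁) (S₂.compLp g₂), S₁.coeFn_compLp g₁, S₂.coeFn_compLp g₂]
      with z k1 k2 k3 k4
    rw [k1, Pi.smul_apply, k2, Pi.add_apply, k3, k4]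
    rfl

/-! ### Weyl sequences and the essential spectrum -/

section Operators

/-- `v` is a singular Weyl sequence for the operator `A` at `l`. -/
def IsSingularWeylSequence {H : Type*} [NormedAddCommGroup H] [InnerProductSpace ℂ H]
    (A : H →ₗ.[ℂ] H) (l : ℂ) (v : ℕ → A.domain) : Prop :=
  (∀ n, ‖(v n : H)‖ = 1) ∧
  (∀ w : H, Tendsto (fun n => ⟪w, (v n : H)⟫_ℂ) atTop (𝓝 0)) ∧
  Tendsto (fun n => ‖A (v n) - l • (v n : H)‖) atTop (𝓝 0)

/-- `A - l`, as a linear map on the domain of `A`. -/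
def shift {H : Type*} [NormedAddCommGroup H] [InnerProductSpace ℂ H]
    (A : H →ₗ.[ℂ] H) (l : ℂ) : A.domain →ₗ[ℂ] H := A.toFun - l • A.domain.subtype

/-- The essential spectrum: the `l ∈ ℂ` for which `A - l` is not Fredholm, i.e. fails to have
finite-dimensional kernel, closed range and finite-dimensional cokernel. -/
def essentialSpectrum {H : Type*} [NormedAddCommGroup H] [InnerProductSpace ℂ H]
    (A : H →ₗ.[ℂ] H) : Set ℂ :=
  {l | ¬ (FiniteDimensional ℂ (LinearMap.ker (shift A l)) ∧
    IsClosed (LinearMap.range (shift A l) : Set H) ∧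
    FiniteDimensional ℂ (H ⧸ LinearMap.range (shift A l)))}

/-- `A` is a self-adjoint realisation of `D_η`: a self-adjoint extension of `D_η`. -/
def IsSelfAdjointRealisation (Ω : Set ℂ) (η : ℂ → ℝ) (A : L2 Ω →ₗ.[ℂ] L2 Ω) : Prop :=
  IsSelfAdjoint A ∧ diracOp Ω η ≤ A

end Operators

/-! ### The explicit sequence -/

/-- A smooth cut-off with values in `[0, 1]`, equal to `1` on `(-∞, 1/2]` and to `0` on
`[1, ∞)`. -/
def IsCutoff (χ : ℝ → ℝ) : Prop :=
  ContDiff ℝ ∞ χ ∧ (∀ x, χ x ∈ Icc (0 : ℝ) 1) ∧ (∀ x ≤ 1 / 2, χ x = 1) ∧ ∀ x, 1 ≤ x → χ x = 0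

/-- `χ(|z - s₀| / R) (z - c)⁻ᵐ (1, B t)`. -/
def weylFun (χ : ℝ → ℝ) (B : ℂ → ℝ) (t : ℂ → ℂ) (s₀ c : ℂ) (R : ℝ) (m : ℕ) (z : ℂ) : Spinor :=
  ((χ (‖z - s₀‖ / R) : ℂ) * ((z - c) ^ m)⁻¹) • !₂[1, (B z : ℂ) * t z]

end DiracBilliard

end

noncomputable section

namespace DiracBilliard

/-! ### Operators -/

section Operators

variable {H : Type*} [NormedAddCommGroup H] [InnerProductSpace ℂ H]

/-! On a spinor `(f, g)` the Dirac expression acts as `-2i (∂g, ∂̄f)`, so it annihilates `(f, 0)`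
for every holomorphic `f`. Where `1 + sin η > 0`, the boundary condition reads `g = B t f` with `B =
cos η / (1 + sin η)`. If `sin η(s₀) = 1`, then `B` vanishes to second order at `s₀`, so the
condition nearly allows `(f, 0)` with `f` concentrated there.

Take `f` to be a cut-off pole of order `m` at a point `c = s₀ + ε ν` just outside `Ω`, and set `g =
f F` with `F` an extension of `B t`. Three effects are balanced in `exists_isWeylProfile`. (a) In
`∂(f F)` the factor `m / |z - c|` from differentiating the pole is absorbed by `|F| ≤ δ |z - s₀| ≤ 2
δ |z - c|`; `δ` is as small as desired once the radius `R` is small, depending on `m`. (b) The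
cut-off error lives at distance at least `R / 2` from `s₀` and is bounded independently of `ε`. (c)
The `L²` norm of the pole over an interior cone tends to infinity as `ε → 0`
(`exists_le_lintegral_inv_pow`). Choosing `R` first and `ε` last makes `‖T φ‖ ≤ ‖φ‖ / m`, while
`|f'| ≈ m |f| / |z - c|` forces `‖∂₁ φ‖ ≥ m ‖φ‖ / 8`. Supports shrinking to `s₀` give weak
convergence to `0`. The case `sin η(s₀) = -1` reduces to `-η` by the charge conjugation `(p, q) ↦
(q̄, p̄)`.

A singular Weyl sequence is incompatible with a finite-dimensional kernel and closed range, because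
a closed operator is then bounded below off its kernel. If a self-adjoint extension had its domain
in `H¹`, the closed graph theorem would bound `‖∂₁ u‖` by the graph norm, against the growth of `∂₁
φ`. -/

theorem IsSingularWeylSequence.of_le {A A' : H →ₗ.[ℂ] H} (hA : A ≤ A') {l : ℂ} {v : ℕ → A.domain}
    (hv : IsSingularWeylSequence A l v) :
    IsSingularWeylSequence A' l (fun n => ⟨v n, hA.1 (v n).2⟩) := by
  refine ⟨hv.1, hv.2.1, hv.2.2.congr fun n => ?_⟩
  rw [hA.2 (x := v n) (y := ⟨v n, hA.1 (v n).2⟩) rfl]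

/-- On the orthogonal complement of its kernel, a closed operator with finite-dimensional kernel
and closed range is bounded below. -/
theorem exists_bound_orthogonal_ker [CompleteSpace H] {A : H →ₗ.[ℂ] H} (hA : A.IsClosed)
    {K : Submodule ℂ H} [K.HasOrthogonalProjection]
    (hK : ∀ x : A.domain, A x = 0 ↔ (x : H) ∈ K) (hKA : K ≤ A.domain)
    (hR : IsClosed (LinearMap.range A.toFun : Set H)) :
    ∃ c : ℝ, ∀ x : A.domain, (x : H) ∈ Kᗮ → ‖(x : H)‖ ≤ c * ‖A x‖ := by
  -- The graph over `Kᗮ` is a Banach space on which the second projection is injective with the same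
  -- range as `A`; the bounded inverse theorem then gives the bound.
  let G : Submodule ℂ (H × H) := A.graph ⊓ Kᗮ.prod ⊤
  have hG : IsClosed (G : Set (H × H)) :=
    IsClosed.inter hA ((Submodule.isClosed_orthogonal K).prod isClosed_univ)
  have : CompleteSpace G := hG.completeSpace_coe
  let S : G →L[ℂ] H := (ContinuousLinearMap.snd ℂ H H).comp G.subtypeL
  have hinj : Function.Injective S := by
    rw [injective_iff_map_eq_zero]
    rintro ⟨⟨x, y⟩, hx, hxK⟩ hy
    obtain ⟨z, rfl, rfl⟩ := (LinearPMap.mem_graph_iff A).1 hx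
    have hz : A z = 0 := hy
    have h0 : (z : H) = 0 := by
      have := Submodule.inner_right_of_mem_orthogonal ((hK z).1 hz) hxK.1
      simpa using this
    ext
    · exact h0
    · exact hz
  have hrange : range S = (LinearMap.range A.toFun : Set H) := by
    ext y
    constructor
    · rintro ⟨⟨⟨x, y⟩, hx, hxK⟩, rfl⟩
      obtain ⟨z, rfl, rfl⟩ := (LinearPMap.mem_graph_iff A).1 hx
      exact ⟨z, rfl⟩
    · rintro ⟨z, rfl⟩
      -- Removing the kernel component leaves `A z` unchanged and moves `z` into `Kᗮ`.
      let p : A.domain := ⟨K.starProjection z, hKA (Submodule.starProjection_apply_mem K _)⟩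
      have hp : A p = 0 := (hK p).2 (Submodule.starProjection_apply_mem K _)
      refine ⟨⟨(((z - p : A.domain) : H), A (z - p)), A.mem_graph _, ?_, trivial⟩, ?_⟩
      · exact Submodule.sub_starProjection_mem_orthogonal (K := K) (z : H)
      · change A (z - p) = A z
        rw [LinearPMap.map_sub, hp, sub_zero]
  have hcl : IsClosed (range S) := hrange ▸ hR
  obtain ⟨c, hc⟩ := S.antilipschitz_of_injective_of_isClosed_range hinj hcl
  refine ⟨c, fun x hx => ?_⟩
  have h := hc.le_mul_norm (map_zero S) (⟨((x : H), A x), A.mem_graph x, hx, trivial⟩ : G)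
  exact (norm_fst_le ((x : H), A x)).trans h

/-- A singular Weyl sequence of a closed operator at `0` puts `0` into the essential spectrum. -/
theorem IsSingularWeylSequence.zero_mem_essentialSpectrum [CompleteSpace H] {A : H →ₗ.[ℂ] H}
    (hA : A.IsClosed) {v : ℕ → A.domain} (hv : IsSingularWeylSequence A 0 v) :
    (0 : ℂ) ∈ essentialSpectrum A := by
  rintro ⟨hfin, hcl, -⟩
  have hs : shift A 0 = A.toFun := by rw [shift, zero_smul, sub_zero]
  rw [hs] at hfin hcl
  let K : Submodule ℂ H := (LinearMap.ker A.toFun).map A.domain.subtype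
  have : FiniteDimensional ℂ K := inferInstance
  have hK : ∀ x : A.domain, A x = 0 ↔ (x : H) ∈ K := by
    intro x
    constructor
    · exact fun h => ⟨x, h, rfl⟩
    · rintro ⟨y, hy, hyx⟩
      obtain rfl : y = x := Subtype.ext hyx
      exact hy
  have hKA : K ≤ A.domain := by
    rintro _ ⟨y, -, rfl⟩
    exact y.2
  obtain ⟨c, hc⟩ := exists_bound_orthogonal_ker hA hK hKA hcl
  -- `K` is finite-dimensional, so its projection is a finite sum of inner products with fixed
  -- vectors and turns weak convergence into norm convergence.
  have hweak : Tendsto (fun n => K.starProjection (v n : H)) atTop (𝓝 0) := by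
    let b := stdOrthonormalBasis ℂ K
    have h1 : ∀ n, K.starProjection (v n : H) = ∑ i, ⟪(b i : H), (v n : H)⟫_ℂ • (b i : H) :=
      fun n => by
        rw [Submodule.starProjection_apply, b.orthogonalProjectionOnto_apply_eq_sum]
        simp
    simp only [h1]
    rw [show (0 : H) = ∑ i, (0 : ℂ) • (b i : H) by simp]
    exact tendsto_finsetSum _ fun i _ => (hv.2.1 (b i)).smul_const _
  have hA0 : Tendsto (fun n => ‖A (v n)‖) atTop (𝓝 0) := by
    refine hv.2.2.congr fun n => ?_
    rw [zero_smul, sub_zero]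
  -- A unit vector is split along `K` and `Kᗮ`; both terms on the right tend to `0`, which is the
  -- contradiction.
  have hbound : ∀ n, (1 : ℝ) ≤ ‖K.starProjection (v n : H)‖ + c * ‖A (v n)‖ := by
    intro n
    let p : A.domain := ⟨K.starProjection (v n : H), hKA (Submodule.starProjection_apply_mem K _)⟩
    have hp : A p = 0 := (hK p).2 (Submodule.starProjection_apply_mem K _)
    have h1 := hc (v n - p) (Submodule.sub_starProjection_mem_orthogonal (K := K) (v n : H))
    rw [LinearPMap.map_sub, hp, sub_zero] at h1
    rw [← hv.1 n]
    calc ‖(v n : H)‖ = ‖(p : H) + ((v n - p : A.domain) : H)‖ := by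
          congr 1
          simp
      _ ≤ ‖(p : H)‖ + ‖((v n - p : A.domain) : H)‖ := norm_add_le _ _
      _ ≤ _ := by gcongr
  have hlim := hweak.norm.add (hA0.const_mul c)
  rw [norm_zero, mul_zero, add_zero] at hlim
  exact absurd (ge_of_tendsto' hlim hbound) (by norm_num)

end Operators

/-! ### Weak derivatives -/

/-- Cauchy–Schwarz against a fixed test function; this passes weak-derivative identities to `L²`
limits. -/
theorem tendsto_integral_smul_L2 {Ω : Set ℂ} {ψ : ℂ → ℝ} (hc : Continuous ψ)
    (hs : HasCompactSupport ψ) {x : ℕ → L2 Ω} {y : L2 Ω} (hx : Tendsto x atTop (𝓝 y)) :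
    Tendsto (fun n => ∫ z in Ω, ψ z • x n z) atTop (𝓝 (∫ z in Ω, ψ z • y z)) := by
  have h2 : MemLp ψ 2 (volume.restrict Ω) := (hc.memLp_of_hasCompactSupport hs).restrict Ω
  rw [tendsto_iff_norm_sub_tendsto_zero]
  have hx' := (tendsto_iff_norm_sub_tendsto_zero.1 hx).const_mul
    (eLpNorm ψ 2 (volume.restrict Ω)).toReal
  rw [mul_zero] at hx'
  refine squeeze_zero (fun _ => norm_nonneg _) (fun n => ?_) hx'
  rw [← integral_sub (integrable_smul_L2 hc hs _) (integrable_smul_L2 hc hs _)]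
  have e1 : ∫ z in Ω, (ψ z • x n z - ψ z • y z)
      = ∫ z in Ω, (ψ • ((x n - y : L2 Ω) : ℂ → Spinor)) z := by
    refine integral_congr_ae ?_
    filter_upwards [Lp.coeFn_sub (x n) y] with z hz
    rw [Pi.smul_apply', hz, Pi.sub_apply, smul_sub]
  rw [e1, Lp.norm_def, ← ENNReal.toReal_mul, ← toReal_enorm]
  refine ENNReal.toReal_mono (ENNReal.mul_ne_top h2.eLpNorm_ne_top (Lp.eLpNorm_ne_top _)) ?_
  refine (enorm_integral_le_lintegral_enorm _).trans ?_
  rw [← eLpNorm_one_eq_lintegral_enorm]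
  exact eLpNorm_smul_le_mul_eLpNorm (Lp.aestronglyMeasurable _) h2.1

theorem HasWeakDeriv.unique {Ω : Set ℂ} (hΩ : IsOpen Ω) {e : ℂ} {u g k : L2 Ω}
    (hg : HasWeakDeriv Ω e u g) (hk : HasWeakDeriv Ω e u k) : g = k := by
  have h := hg.add (hk.smul (-1))
  rw [neg_one_smul, neg_one_smul, add_neg_cancel, ← sub_eq_add_neg] at h
  exact sub_eq_zero.1 (h.eq_zero hΩ)

/-- Weak differentiation is a closed operation, the hypothesis that the closed graph theorem needs
below. -/
theorem HasWeakDeriv.of_tendsto {Ω : Set ℂ} {e : ℂ} {u g : ℕ → L2 Ω} {v k : L2 Ω}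
    (h : ∀ n, HasWeakDeriv Ω e (u n) (g n)) (hu : Tendsto u atTop (𝓝 v))
    (hg : Tendsto g atTop (𝓝 k)) : HasWeakDeriv Ω e v k := by
  intro φ hφ hc hs
  refine tendsto_nhds_unique
    (tendsto_integral_smul_L2 (continuous_dir hφ e) (hc.fderiv_apply ℝ e) hu) ?_
  refine ((tendsto_integral_smul_L2 hφ.continuous hc hg).neg).congr fun n => ?_
  exact (h n φ hφ hc hs).symm

/-- If every element of the domain of a closed operator has a weak derivative in `L²`, then this
derivative is bounded by the graph norm. -/
theorem exists_weakDeriv_bound {Ω : Set ℂ} (hΩ : IsOpen Ω) {e : ℂ} {A : L2 Ω →ₗ.[ℂ] L2 Ω}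
    (hA : A.IsClosed) (h : ∀ u ∈ A.domain, ∃ g, HasWeakDeriv Ω e u g) :
    ∃ c : ℝ, ∀ (u : A.domain) (g : L2 Ω), HasWeakDeriv Ω e u g →
      ‖g‖ ≤ c * max ‖(u : L2 Ω)‖ ‖A u‖ := by
  have hmem : ∀ x : A.graph, x.1.1 ∈ A.domain := by
    rintro ⟨x, hx⟩
    obtain ⟨z, hz, -⟩ := (LinearPMap.mem_graph_iff A).1 hx
    exact hz ▸ z.2
  -- Uniqueness of weak derivatives makes the chosen derivative linear.
  choose d hd using fun x : A.graph => h _ (hmem x)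
  let D : A.graph →ₗ[ℂ] L2 Ω :=
    { toFun := d
      map_add' := fun x y => (hd (x + y)).unique hΩ ((hd x).add (hd y))
      map_smul' := fun c x => (hd (c • x)).unique hΩ ((hd x).smul c) }
  have : CompleteSpace A.graph :=
    (show IsClosed (A.graph : Set (L2 Ω × L2 Ω)) from hA).completeSpace_coe
  -- Closed graph theorem on the graph of `A`, which is complete because `A` is closed.
  have hD : Continuous D := D.continuous_of_seq_closed_graph fun x y w hx hw => by
    have hx1 : Tendsto (fun n => (x n).1.1) atTop (𝓝 y.1.1) :=
      (continuous_fst.comp continuous_subtype_val).continuousAt.tendsto.comp hx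
    exact (HasWeakDeriv.of_tendsto (fun n => hd (x n)) hx1 hw).unique hΩ (hd y)
  let D' : A.graph →L[ℂ] L2 Ω := ⟨D, hD⟩
  refine ⟨‖D'‖, fun u g hg => ?_⟩
  have h1 := D'.le_opNorm ⟨((u : L2 Ω), A u), A.mem_graph u⟩
  rwa [show D' ⟨((u : L2 Ω), A u), A.mem_graph u⟩ = g from
    (hd ⟨((u : L2 Ω), A u), A.mem_graph u⟩).unique hΩ hg] at h1

/-! ### `C¹` spinors with compact support -/

/-- The class in `L²(Ω, ℂ²)` of a continuous compactly supported function. -/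
def classL2 (Ω : Set ℂ) {f : ℂ → Spinor} (hf : Continuous f) (hc : HasCompactSupport f) : L2 Ω :=
  ((hf.memLp_of_hasCompactSupport hc (p := 2) (μ := volume)).restrict Ω).toLp f

theorem coeFn_classL2 (Ω : Set ℂ) {f : ℂ → Spinor} (hf : Continuous f) (hc : HasCompactSupport f) :
    classL2 Ω hf hc =ᵐ[volume.restrict Ω] f :=
  MemLp.coeFn_toLp _

/-- The test function is supported in `Ω`, so both integrals extend to the whole plane, where
integration by parts needs no regularity of the boundary. -/
theorem hasWeakDeriv_classL2 (Ω : Set ℂ) {φ : ℂ → Spinor} (hφ : ContDiff ℝ 1 φ)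
    (hc : HasCompactSupport φ) (e : ℂ) :
    HasWeakDeriv Ω e (classL2 Ω hφ.continuous hc)
      (classL2 Ω (f := fun z => fderiv ℝ φ z e)
        ((hφ.continuous_fderiv (by simp)).clm_apply continuous_const) (hc.fderiv_apply ℝ e)) := by
  have hd : Continuous fun z => fderiv ℝ φ z e :=
    (hφ.continuous_fderiv (by simp)).clm_apply continuous_const
  have hdc : HasCompactSupport fun z => fderiv ℝ φ z e := hc.fderiv_apply ℝ e
  intro ψ hψ hψc hψs
  have hψd := continuous_dir hψ e
  have hψdc : HasCompactSupport fun z => fderiv ℝ ψ z e := hψc.fderiv_apply ℝ e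
  have hz : ∀ z ∉ Ω, z ∉ tsupport ψ := fun z hz h => hz (hψs h)
  have e1 : ∫ z in Ω, (fderiv ℝ ψ z e) • classL2 Ω hφ.continuous hc z
      = ∫ z, (fderiv ℝ ψ z e) • φ z := by
    refine Eq.trans ?_
      (setIntegral_eq_integral_of_forall_compl_eq_zero (s := Ω) (μ := volume) fun z h => ?_)
    · refine integral_congr_ae ?_
      filter_upwards [coeFn_classL2 Ω hφ.continuous hc] with z h
      rw [h]
    · rw [fderiv_of_notMem_tsupport ℝ (hz z h), zero_apply, zero_smul]
  have e2 : ∫ z in Ω, ψ z • classL2 Ω hd hdc z = ∫ z, ψ z • fderiv ℝ φ z e := by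
    refine Eq.trans ?_
      (setIntegral_eq_integral_of_forall_compl_eq_zero (s := Ω) (μ := volume) fun z h => ?_)
    · refine integral_congr_ae ?_
      filter_upwards [coeFn_classL2 Ω hd hdc] with z h
      rw [h]
    · rw [image_eq_zero_of_notMem_tsupport (hz z h), zero_smul]
  rw [e1, e2, integral_smul_fderiv_eq_neg_fderiv_smul_of_integrable, neg_neg]
  · exact (hψd.smul hφ.continuous).integrable_of_hasCompactSupport hψdc.smul_right
  · exact (hψ.continuous.smul hd).integrable_of_hasCompactSupport hψc.smul_right
  · exact (hψ.continuous.smul hφ.continuous).integrable_of_hasCompactSupport hψc.smul_right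
  · exact fun z _ => hψ.differentiable (by simp) z
  · exact fun z _ => hφ.differentiable (by simp) z

/-- The constant sequence `φ` serves as approximation. -/
theorem hasTrace_classL2 (Ω : Set ℂ) {φ : ℂ → Spinor} (hφ : ContDiff ℝ 1 φ)
    (hc : HasCompactSupport φ) : HasTrace Ω (classL2 Ω hφ.continuous hc) φ := by
  have key : ∀ {f : ℂ → Spinor} (hf : Continuous f) (hc : HasCompactSupport f),
      Tendsto (fun _ : ℕ => eLpNorm (fun z => f z - classL2 Ω hf hc z) 2 (volume.restrict Ω)) atTop
        (𝓝 0) := by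
    intro f hf hc
    have : (fun z => f z - classL2 Ω hf hc z) =ᵐ[volume.restrict Ω] 0 := by
      filter_upwards [coeFn_classL2 Ω hf hc] with z h
      rw [h, sub_self, Pi.zero_apply]
    simp only [eLpNorm_congr_ae this, eLpNorm_zero, tendsto_const_nhds]
  refine ⟨hφ.continuous.aestronglyMeasurable, _, _, hasWeakDeriv_classL2 Ω hφ hc 1,
    hasWeakDeriv_classL2 Ω hφ hc Complex.I, fun _ => φ, fun _ => hφ, key _ _, key _ _, key _ _, ?_⟩
  simp

/-- `T φ` for a `C¹` function `φ`. -/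
def diracField (φ : ℂ → Spinor) (z : ℂ) : Spinor :=
  diracSymbol (fderiv ℝ φ z 1) (fderiv ℝ φ z Complex.I)

theorem continuous_diracField {φ : ℂ → Spinor} (hφ : ContDiff ℝ 1 φ) :
    Continuous (diracField φ) := by
  have hd : ∀ e, Continuous fun z => fderiv ℝ φ z e := fun e =>
    (hφ.continuous_fderiv (by simp)).clm_apply continuous_const
  exact (((Matrix.toEuclideanLin pauli1).continuous_of_finiteDimensional.comp (hd 1)).add
    ((Matrix.toEuclideanLin pauli2).continuous_of_finiteDimensional.comp (hd Complex.I))).const_smul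
      (-Complex.I)

theorem hasCompactSupport_diracField {φ : ℂ → Spinor} (hc : HasCompactSupport φ) :
    HasCompactSupport (diracField φ) := by
  refine hc.mono' fun z hz => ?_
  by_contra h
  refine hz ?_
  rw [diracField, fderiv_of_notMem_tsupport ℝ h]
  simp [diracSymbol]

/-- A `C¹` function satisfying the boundary condition is in the domain of `D_η`. -/
theorem memDiracDomain_classL2 {Ω : Set ℂ} {η : ℂ → ℝ} {φ : ℂ → Spinor}
    (hφ : ContDiff ℝ 1 φ) (hc : HasCompactSupport φ)
    (hb : ∀ s ∈ frontier Ω, Matrix.toEuclideanLin (projMinus (η s) (unitTangent Ω s)) (φ s) = 0) :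
    classL2 Ω hφ.continuous hc ∈ (diracOp Ω η).domain := by
  rw [mem_domain_diracOp]
  refine ⟨⟨⟨_, hasWeakDeriv_classL2 Ω hφ hc 1⟩, ⟨_, hasWeakDeriv_classL2 Ω hφ hc Complex.I⟩⟩, φ,
    hasTrace_classL2 Ω hφ hc, ?_⟩
  exact ae_restrict_of_forall_mem isClosed_frontier.measurableSet hb

theorem diracOp_classL2 {Ω : Set ℂ} {η : ℂ → ℝ} (hΩ : IsOpen Ω) {φ : ℂ → Spinor}
    (hφ : ContDiff ℝ 1 φ) (hc : HasCompactSupport φ)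
    (h : classL2 Ω hφ.continuous hc ∈ (diracOp Ω η).domain) :
    diracOp Ω η ⟨classL2 Ω hφ.continuous hc, h⟩ =
      classL2 Ω (continuous_diracField hφ) (hasCompactSupport_diracField hc) := by
  have hg : (classL2 Ω hφ.continuous hc,
      classL2 Ω (continuous_diracField hφ) (hasCompactSupport_diracField hc)) ∈
      (diracOp Ω η).graph := by
    rw [mem_graph_diracOp hΩ]
    refine ⟨(mem_domain_diracOp Ω η _).1 h, _, _, hasWeakDeriv_classL2 Ω hφ hc 1,
      hasWeakDeriv_classL2 Ω hφ hc Complex.I, ?_⟩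
    filter_upwards [coeFn_classL2 Ω (continuous_diracField hφ) (hasCompactSupport_diracField hc),
      coeFn_classL2 Ω (f := fun z => fderiv ℝ φ z 1)
        ((hφ.continuous_fderiv (by simp)).clm_apply continuous_const) (hc.fderiv_apply ℝ 1),
      coeFn_classL2 Ω (f := fun z => fderiv ℝ φ z Complex.I)
        ((hφ.continuous_fderiv (by simp)).clm_apply continuous_const)
        (hc.fderiv_apply ℝ Complex.I)] with z h1 h2 h3
    rw [h1, h2, h3, diracField]
  exact LinearPMap.mem_graph_snd_inj _ (LinearPMap.mem_graph _ _) hg rfl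

/-- Minkowski's inequality; on a set of finite measure the constant `K` contributes `K |Ω|^{1/2}`.
All pointwise estimates enter `L²` in this form. -/
theorem norm_le_of_ae_le_add {Ω : Set ℂ} (hΩ : volume Ω ≠ ⊤) {f g : L2 Ω} {a K : ℝ} (ha : 0 ≤ a)
    (hK : 0 ≤ K) (h : ∀ᵐ z ∂(volume.restrict Ω), ‖f z‖ ≤ a * ‖g z‖ + K) :
    ‖f‖ ≤ a * ‖g‖ + K * ((volume Ω) ^ (1 / 2 : ℝ)).toReal := by
  have h1 : eLpNorm f 2 (volume.restrict Ω) ≤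
      ENNReal.ofReal a * eLpNorm g 2 (volume.restrict Ω)
        + ENNReal.ofReal K * (volume Ω) ^ (1 / 2 : ℝ) := by
    calc eLpNorm f 2 (volume.restrict Ω)
        ≤ eLpNorm ((a • fun z => ‖g z‖) + fun _ => K) 2 (volume.restrict Ω) :=
          eLpNorm_mono_ae_real h
      _ ≤ eLpNorm (a • fun z => ‖g z‖) 2 (volume.restrict Ω)
          + eLpNorm (fun _ : ℂ => K) 2 (volume.restrict Ω) :=
          eLpNorm_add_le ((Lp.aestronglyMeasurable g).norm.const_smul a)
            aestronglyMeasurable_const (by norm_num)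
      _ ≤ _ := by
          rw [eLpNorm_const_smul, eLpNorm_norm, Real.enorm_eq_ofReal ha]
          gcongr
          rw [eLpNorm_const' _ (by norm_num) (by norm_num), Real.enorm_eq_ofReal hK,
            Measure.restrict_apply_univ]
          norm_num
  have hV : (volume Ω) ^ (1 / 2 : ℝ) ≠ ⊤ :=
    ENNReal.rpow_ne_top_of_nonneg (y := (1 / 2 : ℝ)) (by norm_num) hΩ
  rw [Lp.norm_def, Lp.norm_def]
  have h2 := ENNReal.toReal_mono (ENNReal.add_ne_top.2
    ⟨ENNReal.mul_ne_top ENNReal.ofReal_ne_top (Lp.eLpNorm_ne_top g),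
      ENNReal.mul_ne_top ENNReal.ofReal_ne_top hV⟩) h1
  rwa [ENNReal.toReal_add (ENNReal.mul_ne_top ENNReal.ofReal_ne_top (Lp.eLpNorm_ne_top g))
      (ENNReal.mul_ne_top ENNReal.ofReal_ne_top hV), ENNReal.toReal_mul, ENNReal.toReal_mul,
    ENNReal.toReal_ofReal ha, ENNReal.toReal_ofReal hK] at h2

/-- Normalised functions with supports shrinking to a point converge weakly to `0`. -/
theorem tendsto_inner_zero_of_support {Ω : Set ℂ} {s₀ : ℂ} {R : ℕ → ℝ}
    (hR : Tendsto R atTop (𝓝 0)) {v : ℕ → L2 Ω} (hv : ∀ n, ‖v n‖ ≤ 1)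
    (hs : ∀ n, ∀ᵐ z ∂(volume.restrict Ω), z ∉ Metric.closedBall s₀ (R n) → v n z = 0) (w : L2 Ω) :
    Tendsto (fun n => ⟪w, v n⟫_ℂ) atTop (𝓝 0) := by
  let S : ℕ → Set ℂ := fun n => Metric.closedBall s₀ (R n)
  have hS : ∀ n, MeasurableSet (S n) := fun n => Metric.isClosed_closedBall.measurableSet
  have hw2 : ∀ n, MemLp ((S n).indicator w) 2 (volume.restrict Ω) := fun n =>
    (Lp.memLp w).indicator (hS n)
  -- Dominated convergence: the balls shrink to the null set `{s₀}`.
  have hzero : Tendsto (fun n => eLpNorm ((S n).indicator w) 2 (volume.restrict Ω)) atTop (𝓝 0) := by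
    have h2 : ∀ n, eLpNorm ((S n).indicator w) 2 (volume.restrict Ω)
        = (∫⁻ z in Ω, (S n).indicator (fun z => ‖w z‖ₑ ^ (2 : ℝ)) z) ^ (1 / 2 : ℝ) := by
      intro n
      rw [eLpNorm_eq_lintegral_rpow_enorm_toReal (by norm_num) (by norm_num)]
      congr 1
      refine lintegral_congr fun z => ?_
      by_cases hz : z ∈ S n <;> simp [hz]
    simp only [h2]
    have h3 : Tendsto (fun n => ∫⁻ z in Ω, (S n).indicator (fun z => ‖w z‖ₑ ^ (2 : ℝ)) z) atTop
        (𝓝 (∫⁻ _ in Ω, 0)) := by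
      have hwm : AEMeasurable (fun z => ‖w z‖ₑ ^ (2 : ℝ)) (volume.restrict Ω) :=
        (Lp.aestronglyMeasurable w).enorm.pow_const _
      refine tendsto_lintegral_of_dominated_convergence' (fun z => ‖w z‖ₑ ^ (2 : ℝ))
        (fun n => hwm.indicator (hS n))
        (fun n => Eventually.of_forall fun z => indicator_le_self _ _ z) ?_ ?_
      · have := lintegral_rpow_enorm_lt_top_of_eLpNorm_lt_top (by norm_num) (by norm_num)
          (Lp.eLpNorm_lt_top w)
        simpa using this.ne
      · have hne : ∀ᵐ z ∂(volume.restrict Ω), z ≠ s₀ :=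
          ae_restrict_of_ae (Measure.ae_ne volume s₀)
        filter_upwards [hne] with z hz
        refine tendsto_const_nhds.congr' ?_
        filter_upwards [hR.eventually (gt_mem_nhds (dist_pos.2 hz))] with n hn
        rw [indicator_of_notMem]
        exact fun h => absurd (Metric.mem_closedBall.1 h) (not_le.2 hn)
    rw [lintegral_zero] at h3
    have := (ENNReal.continuous_rpow_const (y := (1 / 2 : ℝ))).continuousAt.tendsto.comp h3
    simpa [Function.comp_def] using this
  have hzero' : Tendsto (fun n => ‖(hw2 n).toLp‖) atTop (𝓝 0) := by
    have := (ENNReal.tendsto_toReal ENNReal.zero_ne_top).comp hzero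
    refine this.congr fun n => ?_
    rw [Lp.norm_toLp]
    rfl
  refine squeeze_zero_norm (fun n => ?_) hzero'
  -- Outside the ball `v n` vanishes, so `w` may be truncated to it.
  have : ⟪w, v n⟫_ℂ = ⟪(hw2 n).toLp, v n⟫_ℂ := by
    rw [L2.inner_def, L2.inner_def]
    refine integral_congr_ae ?_
    filter_upwards [hs n, (hw2 n).coeFn_toLp] with z h1 h2
    rw [h2]
    by_cases hz : z ∈ S n
    · rw [indicator_of_mem hz]
    · rw [h1 hz, inner_zero_right, inner_zero_right]
  rw [this]
  refine (norm_inner_le_norm _ _).trans ?_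
  exact mul_le_of_le_one_right (norm_nonneg _) (hv n)

/-! ### Geometry of the boundary -/

theorem eventually_neg_of_hasDerivAt {g : ℝ → ℝ} {a : ℝ} (hg : HasDerivAt g a 0) (h0 : g 0 = 0)
    (ha : a < 0) : ∀ᶠ τ in 𝓝[>] (0 : ℝ), g τ < 0 := by
  have h1 := (hasDerivAt_iff_tendsto_slope.1 hg).mono_left
    (nhdsWithin_mono 0 fun τ (hτ : 0 < τ) => hτ.ne')
  filter_upwards [h1.eventually (gt_mem_nhds ha), self_mem_nhdsWithin] with τ h2 hτ
  rw [slope_def_field, h0, sub_zero, sub_zero] at h2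
  exact (div_neg_iff.1 h2).elim (fun h => absurd h.2 (not_lt.2 (le_of_lt hτ))) And.left

/-- Near `p`, in the coordinates `z = p + ν (x + i y)`, the set `Ω` is the region `x < h y`. -/
def IsLocalGraph (Ω : Set ℂ) (p ν : ℂ) (h : ℝ → ℝ) (r : ℝ) : Prop :=
  ∀ z ∈ Metric.ball p r,
    (z ∈ Ω ↔ ((z - p) * starRingEnd ℂ ν).re < h ((z - p) * starRingEnd ℂ ν).im)

/-- Along the ray, `x - h y` starts at `0` with derivative `Re e - a Im e`, where `e` is the
direction in the frame of `ν`; the sign of this derivative decides the side. -/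
theorem IsLocalGraph.eventually_ray {Ω : Set ℂ} {p ν : ℂ} {h : ℝ → ℝ} {r : ℝ}
    (hΩ : IsLocalGraph Ω p ν h r) {q d : ℂ} (hq : q ∈ Metric.ball p r) {a : ℝ}
    (hh : HasDerivAt h a ((q - p) * starRingEnd ℂ ν).im)
    (hqh : ((q - p) * starRingEnd ℂ ν).re = h ((q - p) * starRingEnd ℂ ν).im) :
    ((d * starRingEnd ℂ ν).re < a * (d * starRingEnd ℂ ν).im →
      ∀ᶠ τ : ℝ in 𝓝[>] 0, q + τ * d ∈ Ω) ∧
    (a * (d * starRingEnd ℂ ν).im < (d * starRingEnd ℂ ν).re →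
      ∀ᶠ τ : ℝ in 𝓝[>] 0, q + τ * d ∉ Ω) := by
  set w := (q - p) * starRingEnd ℂ ν
  set e := d * starRingEnd ℂ ν
  have hw : ∀ τ : ℝ, (q + τ * d - p) * starRingEnd ℂ ν = w + τ * e := fun τ => by
    simp only [w, e]
    ring
  have hre : ∀ τ : ℝ, (w + τ * e).re = w.re + τ * e.re := fun τ => by simp
  have him : ∀ τ : ℝ, (w + τ * e).im = w.im + τ * e.im := fun τ => by simp
  have hball : ∀ᶠ τ : ℝ in 𝓝[>] 0, q + τ * d ∈ Metric.ball p r := by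
    refine nhdsWithin_le_nhds ?_
    have hc : Continuous fun τ : ℝ => q + τ * d := by fun_prop
    exact hc.continuousAt.preimage_mem_nhds (Metric.isOpen_ball.mem_nhds (by simpa using hq))
  have hl : ∀ c k : ℝ, HasDerivAt (fun τ : ℝ => c + τ * k) k 0 := fun c k => by
    simpa using ((hasDerivAt_id (0 : ℝ)).mul_const k).const_add c
  have hd : HasDerivAt (fun τ : ℝ => (w.re + τ * e.re) - h (w.im + τ * e.im))
      (e.re - a * e.im) 0 := by
    have hh' : HasDerivAt h a (w.im + 0 * e.im) := by simpa using hh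
    exact (hl _ _).sub (hh'.comp (0 : ℝ) (hl _ _))
  constructor
  · intro hlt
    have h1 := eventually_neg_of_hasDerivAt hd (by simp [hqh]) (by linarith)
    filter_upwards [h1, hball] with τ h2 h3
    rw [hΩ _ h3, hw, hre, him]
    linarith
  · intro hlt
    have h1 := eventually_neg_of_hasDerivAt hd.neg (by simp [hqh]) (by linarith)
    filter_upwards [h1, hball] with τ h2 h3
    rw [hΩ _ h3, hw, hre, him]
    simp only [Pi.neg_apply] at h2
    linarith

theorem mul_conj_of_norm_eq_one {ν : ℂ} (hν : ‖ν‖ = 1) : ν * starRingEnd ℂ ν = 1 := by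
  rw [Complex.mul_conj, Complex.normSq_eq_norm_sq, hν]
  norm_num

/-- The outward normal of a local graph. -/
theorem IsOutwardNormal.eq_of_isLocalGraph {Ω : Set ℂ} {p ν q μ : ℂ} {h : ℝ → ℝ} {r a : ℝ}
    (hΩ : IsLocalGraph Ω p ν h r) (hν : ‖ν‖ = 1) (hq : q ∈ Metric.ball p r)
    (hh : HasDerivAt h a ((q - p) * starRingEnd ℂ ν).im)
    (hqh : ((q - p) * starRingEnd ℂ ν).re = h ((q - p) * starRingEnd ℂ ν).im)
    (hμ : IsOutwardNormal Ω q μ) :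
    μ = ν * ((1 - a * Complex.I) / (Real.sqrt (1 + a ^ 2) : ℝ)) := by
  obtain ⟨hμ1, k, r', hr', hk, hk0, hk', hΩ'⟩ := hμ
  have hkd : HasDerivAt k 0 ((q - q) * starRingEnd ℂ μ).im := by
    have := (hk.differentiable (by simp) 0).hasDerivAt
    rw [hk'] at this
    rwa [sub_self, zero_mul, Complex.zero_im]
  -- A direction strictly inward for the graph at `q` with normal `μ` cannot be strictly outward for
  -- the graph with normal `ν`. This inclusion of half-planes determines `μ`.
  have key : ∀ d : ℂ, (d * starRingEnd ℂ μ).re < 0 →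
      (d * starRingEnd ℂ ν).re ≤ a * (d * starRingEnd ℂ ν).im := by
    intro d hd
    by_contra! hlt
    have h1 := (IsLocalGraph.eventually_ray (d := d) hΩ' (Metric.mem_ball_self hr') hkd
      (by simp [hk0])).1 (by simpa using hd)
    have h2 := (hΩ.eventually_ray (d := d) hq hh hqh).2 hlt
    obtain ⟨τ, h3, h4⟩ := (h1.and h2).exists
    exact h4 h3
  have hμμ := mul_conj_of_norm_eq_one hμ1
  have hνν := mul_conj_of_norm_eq_one hν
  set c := μ * starRingEnd ℂ ν with hc
  have hd : ∀ b : ℂ, b.re < 0 → (b * c).re ≤ a * (b * c).im := by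
    intro b hb
    have := key (b * μ) (by rwa [mul_assoc, hμμ, mul_one])
    rwa [mul_assoc] at this
  have hcn : c.re ^ 2 + c.im ^ 2 = 1 := by
    have h1 : ‖c‖ ^ 2 = 1 := by rw [hc, norm_mul, RCLike.norm_conj, hμ1, hν]; norm_num
    rw [← h1, ← Complex.normSq_eq_norm_sq, Complex.normSq_apply]
    ring
  have hpos : 0 ≤ c.re - a * c.im := by
    have := hd (-1) (by norm_num)
    simp only [neg_mul, one_mul, Complex.neg_re, Complex.neg_im] at this
    linarith
  -- The directions `-ε ± i` in the frame of `μ` are strictly inward; letting `ε → 0` shows that the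
  -- two tangent lines coincide.
  have himeq : c.im + a * c.re = 0 := by
    have h1 : ∀ ε : ℝ, 0 < ε → -c.im - a * c.re ≤ ε * (c.re - a * c.im) := by
      intro ε hε
      have := hd (⟨-ε, 1⟩) (by simpa using hε)
      simp only [Complex.mul_re, Complex.mul_im] at this
      linarith
    have h2 : ∀ ε : ℝ, 0 < ε → c.im + a * c.re ≤ ε * (c.re - a * c.im) := by
      intro ε hε
      have := hd (⟨-ε, -1⟩) (by simpa using hε)
      simp only [Complex.mul_re, Complex.mul_im] at this
      linarith
    have lim : ∀ x y : ℝ, (∀ ε : ℝ, 0 < ε → x ≤ ε * y) → x ≤ 0 := by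
      intro x y hxy
      have ht : Tendsto (fun ε : ℝ => ε * y) (𝓝[>] 0) (𝓝 0) := by
        have : Tendsto (fun ε : ℝ => ε * y) (𝓝 0) (𝓝 (0 * y)) := tendsto_id.mul_const y
        rw [zero_mul] at this
        exact this.mono_left nhdsWithin_le_nhds
      exact ge_of_tendsto ht (eventually_mem_nhdsWithin.mono fun ε hε => hxy ε hε)
    linarith [lim _ _ h1, lim _ _ h2]
  have him : c.im = -a * c.re := by linarith
  have hre0 : 0 ≤ c.re := by
    rw [him] at hpos
    have : 0 ≤ c.re * (1 + a ^ 2) := by linarith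
    exact nonneg_of_mul_nonneg_left this (by positivity)
  -- `|c| = 1` gives the square of this quantity, and `c.re ≥ 0` selects the positive root.
  have hre : c.re * Real.sqrt (1 + a ^ 2) = 1 := by
    have h1 : (c.re * Real.sqrt (1 + a ^ 2)) ^ 2 = 1 := by
      rw [mul_pow, Real.sq_sqrt (by positivity)]
      linear_combination hcn - (c.im - a * c.re) * himeq
    have h2 : 0 ≤ c.re * Real.sqrt (1 + a ^ 2) := mul_nonneg hre0 (Real.sqrt_nonneg _)
    nlinarith
  have hs0 : Real.sqrt (1 + a ^ 2) ≠ 0 := (Real.sqrt_pos.2 (by positivity)).ne'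
  have hceq : c = (1 - a * Complex.I) / (Real.sqrt (1 + a ^ 2) : ℝ) := by
    rw [eq_div_iff (by exact_mod_cast hs0)]
    apply Complex.ext
    · simpa using hre
    · simp only [Complex.mul_im, Complex.ofReal_im, Complex.ofReal_re, him]
      simp
      linear_combination a * hre
  rw [← hceq, hc]
  linear_combination (-μ) * hνν

theorem IsLocalGraph.le_of_mem_closure {Ω : Set ℂ} {p ν : ℂ} {h : ℝ → ℝ} {r : ℝ}
    (hΩ : IsLocalGraph Ω p ν h r) (hh : Continuous h) {z : ℂ} (hz : z ∈ closure Ω)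
    (hzr : z ∈ Metric.ball p r) :
    ((z - p) * starRingEnd ℂ ν).re ≤ h ((z - p) * starRingEnd ℂ ν).im := by
  by_contra! hlt
  have hopen : IsOpen {z : ℂ | h ((z - p) * starRingEnd ℂ ν).im < ((z - p) * starRingEnd ℂ ν).re} :=
    isOpen_lt (by fun_prop) (by fun_prop)
  obtain ⟨y, ⟨hy1, hy2⟩, hy⟩ := mem_closure_iff.1 hz _ (hopen.inter Metric.isOpen_ball) ⟨hlt, hzr⟩
  exact absurd ((hΩ y hy2).1 hy) (not_lt.2 (le_of_lt hy1))

theorem IsLocalGraph.eq_of_mem_frontier {Ω : Set ℂ} (hop : IsOpen Ω) {p ν : ℂ} {h : ℝ → ℝ} {r : ℝ}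
    (hΩ : IsLocalGraph Ω p ν h r) (hh : Continuous h) {z : ℂ} (hz : z ∈ frontier Ω)
    (hzr : z ∈ Metric.ball p r) :
    ((z - p) * starRingEnd ℂ ν).re = h ((z - p) * starRingEnd ℂ ν).im := by
  rw [hop.frontier_eq] at hz
  refine le_antisymm (hΩ.le_of_mem_closure hh hz.1 hzr) (not_lt.1 fun hlt => ?_)
  exact hz.2 ((hΩ z hzr).2 hlt)

/-- The ray in direction `-ν` enters `Ω`, so the point lies in the closure; the strict inequality
fails there, so it is not in `Ω`. -/
theorem IsLocalGraph.mem_frontier {Ω : Set ℂ} (hop : IsOpen Ω) {p ν : ℂ} {h : ℝ → ℝ} {r : ℝ}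
    (hΩ : IsLocalGraph Ω p ν h r) (hν : ‖ν‖ = 1) (hh : Differentiable ℝ h) {z : ℂ}
    (hz : ((z - p) * starRingEnd ℂ ν).re = h ((z - p) * starRingEnd ℂ ν).im)
    (hzr : z ∈ Metric.ball p r) : z ∈ frontier Ω := by
  rw [hop.frontier_eq]
  refine ⟨?_, fun hmem => absurd ((hΩ z hzr).1 hmem) (not_lt.2 hz.ge)⟩
  have h1 := (hΩ.eventually_ray (d := -ν) hzr (hh _).hasDerivAt hz).1
    (by rw [neg_mul, mul_conj_of_norm_eq_one hν]; simp)
  have hc : Tendsto (fun τ : ℝ => z + τ * -ν) (𝓝[>] 0) (𝓝 z) := by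
    have : Continuous fun τ : ℝ => z + τ * -ν := by fun_prop
    simpa using (this.tendsto 0).mono_left nhdsWithin_le_nhds
  exact mem_closure_of_tendsto hc h1

/-- Near a boundary point, `Ω` contains a cone around the inward normal, and the outward normal is
not tangential. -/
theorem IsOutwardNormal.exists_cone {Ω : Set ℂ} {p ν : ℂ} (hν : IsOutwardNormal Ω p ν) :
    ∃ ρ : ℝ, 0 < ρ ∧
      (∀ z ∈ Metric.ball p ρ, ((z - p) * starRingEnd ℂ ν).re < -|((z - p) * starRingEnd ℂ ν).im| →
        z ∈ Ω) ∧
      ∀ z ∈ closure Ω ∩ Metric.ball p ρ, ∀ ε : ℝ, 0 ≤ ε → ‖z - p‖ ≤ 2 * ‖z - (p + ε * ν)‖ := by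
  obtain ⟨hν1, h, r, hr, hh, hh0, hh', hΩ⟩ := hν
  have hd := (hh.differentiable (by simp) 0).hasDerivAt
  rw [hh'] at hd
  -- Since `h 0 = h' 0 = 0`, the boundary stays in the double cone `|x| ≤ |y|` near `p`.
  have hsmall : ∀ᶠ y in 𝓝 (0 : ℝ), |h y| ≤ |y| := by
    have := hd.isLittleO.def zero_lt_one
    simpa [hh0] using this
  obtain ⟨δ, hδ, hδs⟩ := Metric.eventually_nhds_iff.1 hsmall
  have hnorm : ∀ z : ℂ, ‖(z - p) * starRingEnd ℂ ν‖ = ‖z - p‖ := fun z => by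
    rw [norm_mul, RCLike.norm_conj, hν1, mul_one]
  have hle : ∀ z ∈ Metric.ball p (min r δ), |h ((z - p) * starRingEnd ℂ ν).im| ≤
      |((z - p) * starRingEnd ℂ ν).im| := by
    intro z hz
    refine hδs ?_
    rw [Real.dist_eq, sub_zero]
    refine (Complex.abs_im_le_norm _).trans_lt ?_
    rw [hnorm, ← dist_eq_norm]
    exact (Metric.mem_ball.1 hz).trans_le (min_le_right _ _)
  have hsub : Metric.ball p (min r δ) ⊆ Metric.ball p r := Metric.ball_subset_ball (min_le_left _ _)
  refine ⟨min r δ, lt_min hr hδ, fun z hz hlt => ?_, fun z hz ε hε => ?_⟩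
  · rw [hΩ z (hsub hz)]
    have := hle z hz
    linarith [neg_abs_le (h ((z - p) * starRingEnd ℂ ν).im)]
  · have h1 := IsLocalGraph.le_of_mem_closure hΩ hh.continuous hz.1 (hsub hz.2)
    have h2 := hle z hz.2
    have e1 : ‖z - (p + ε * ν)‖ = ‖(z - p) * starRingEnd ℂ ν - ε‖ := by
      rw [show (z - p) * starRingEnd ℂ ν - ε = (z - (p + ε * ν)) * starRingEnd ℂ ν by
        linear_combination ε * mul_conj_of_norm_eq_one hν1, norm_mul, RCLike.norm_conj, hν1, mul_one]
    rw [← hnorm, e1]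
    set w := (z - p) * starRingEnd ℂ ν
    refine abs_le_of_sq_le_sq' ?_ (by positivity) |>.2
    rw [mul_pow, ← Complex.normSq_eq_norm_sq, ← Complex.normSq_eq_norm_sq, Complex.normSq_apply,
      Complex.normSq_apply, Complex.sub_re, Complex.sub_im, Complex.ofReal_re, Complex.ofReal_im]
    have h3 : w.re ≤ |w.im| := h1.trans ((le_abs_self _).trans h2)
    -- If `w.re ≤ 0`, moving the pole outward only increases the distance. Otherwise `w.re ≤
    -- |w.im|`, so `|w|² ≤ 2 w.im² ≤ 2 |w - ε|²`.
    rcases le_total w.re 0 with h4 | h4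
    · nlinarith [mul_nonneg hε (neg_nonneg.2 h4), sq_nonneg w.im, sq_nonneg ε, sq_nonneg w.re]
    · have : w.re ^ 2 ≤ w.im ^ 2 := by
        rw [← sq_abs w.im]
        gcongr
      nlinarith [sq_nonneg (w.re - ε)]

/-- A function of class `C¹` near a point agrees near this point with a `C¹` function. -/
theorem exists_contDiff_eventuallyEq {f : ℂ → ℝ} {p : ℂ} (hf : ContDiffAt ℝ 1 f p) :
    ∃ g : ℂ → ℝ, ContDiff ℝ 1 g ∧ g =ᶠ[𝓝 p] f := by
  have h1 : ∀ᶠ z in 𝓝 p, ContDiffAt ℝ 1 f z := hf.eventually (by simp)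
  obtain ⟨r, hr, hball⟩ := Metric.eventually_nhds_iff_ball.1 h1
  let ψ : ContDiffBump p := ⟨r / 4, r / 2, by positivity, by linarith⟩
  refine ⟨fun z => ψ z * f z, contDiff_iff_contDiffAt.2 fun z => ?_, ?_⟩
  · by_cases hz : z ∈ Metric.ball p r
    · exact (ψ.contDiff.contDiffAt).mul (hball z hz)
    · have h0 : (fun z => ψ z * f z) =ᶠ[𝓝 z] fun _ => 0 := by
        have hts : z ∉ tsupport ψ := by
          rw [ψ.tsupport_eq]
          intro hm
          exact hz (Metric.closedBall_subset_ball (by change r / 2 < r; linarith) hm)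
        filter_upwards [(isClosed_tsupport ψ).isOpen_compl.mem_nhds hts] with y hy
        rw [image_eq_zero_of_notMem_tsupport hy, zero_mul]
      exact contDiffAt_const.congr_of_eventuallyEq h0
  · filter_upwards [ψ.eventuallyEq_one] with z hz
    rw [hz, Pi.one_apply, one_mul]

/-- The functions `B` and `t` that extend `cos η / (1 + sin η)` and the unit tangent. -/
theorem exists_boundary_extension {Ω : Set ℂ} (hop : IsOpen Ω) (hC2 : HasC2Boundary Ω)
    {η : ℂ → ℝ} {s₀ : ℂ} (hs₀ : s₀ ∈ frontier Ω)
    (hη : ∃ η' : ℂ → ℝ, ContDiffAt ℝ 1 η' s₀ ∧ η =ᶠ[𝓝[frontier Ω] s₀] η')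
    (hcos : (fun s => Real.cos (η s)) =O[𝓝[frontier Ω] s₀] fun s => ‖s - s₀‖ ^ 2)
    (hsin : Real.sin (η s₀) = 1) :
    ∃ (R₀ : ℝ) (B : ℂ → ℝ) (t : ℂ → ℂ), 0 < R₀ ∧ ContDiff ℝ 1 B ∧ ContDiff ℝ 1 t ∧
      (∀ s ∈ frontier Ω ∩ Metric.ball s₀ R₀,
        0 < 1 + Real.sin (η s) ∧ B s = Real.cos (η s) / (1 + Real.sin (η s)) ∧
          t s = unitTangent Ω s) ∧ HasFDerivAt B (0 : ℂ →L[ℝ] ℝ) s₀ ∧ B s₀ = 0 := by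
  obtain ⟨η', hη', heq⟩ := hη
  obtain ⟨ν, hν, h, r, hr, hh, hh0, hh', hΩ⟩ := hC2 s₀ hs₀
  have hΩ : IsLocalGraph Ω s₀ ν h r := hΩ
  have hνν := mul_conj_of_norm_eq_one hν
  -- `Y` is the tangential coordinate, and `γ` projects along `ν` onto the boundary graph, fixing
  -- boundary points near `s₀`. Composing with `γ` carries the decay of `cos η`, known only on the
  -- boundary, to a full neighbourhood, so that the whole derivative of `B` vanishes at `s₀`.
  let Y : ℂ → ℝ := fun z => ((z - s₀) * starRingEnd ℂ ν).im
  have hY : ContDiff ℝ 2 Y :=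
    Complex.imCLM.contDiff.comp ((contDiff_id.sub contDiff_const).mul contDiff_const)
  let γ : ℂ → ℂ := fun z => s₀ + ν * (h (Y z) + Y z * Complex.I)
  have hγ : ContDiff ℝ 2 γ := contDiff_const.add (contDiff_const.mul
    ((Complex.ofRealCLM.contDiff.comp (hh.comp hY)).add
      ((Complex.ofRealCLM.contDiff.comp hY).mul contDiff_const)))
  have hγ0 : γ s₀ = s₀ := by simp [γ, Y, hh0]
  have hγw : ∀ z, (γ z - s₀) * starRingEnd ℂ ν = h (Y z) + Y z * Complex.I := fun z => by
    simp only [γ]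
    linear_combination ((h (Y z) : ℂ) + Y z * Complex.I) * hνν
  have hball : ∀ᶠ z in 𝓝 s₀, z ∈ Metric.ball s₀ r := Metric.ball_mem_nhds _ hr
  have hγt : Tendsto γ (𝓝 s₀) (𝓝 s₀) := by
    have := hγ.continuous.tendsto s₀
    rwa [hγ0] at this
  have hγf : Tendsto γ (𝓝 s₀) (𝓝[frontier Ω] s₀) := by
    refine tendsto_nhdsWithin_iff.2 ⟨hγt, ?_⟩
    filter_upwards [hγt.eventually hball] with z hz
    refine hΩ.mem_frontier hop hν (hh.differentiable (by simp)) ?_ hz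
    rw [hγw]
    simp
  have hγid : ∀ᶠ s in 𝓝[frontier Ω] s₀, γ s = s := by
    filter_upwards [nhdsWithin_le_nhds hball, self_mem_nhdsWithin] with s hs hsf
    have h1 := hΩ.eq_of_mem_frontier hop hh.continuous hsf hs
    have h2 : (γ s - s₀) * starRingEnd ℂ ν = (s - s₀) * starRingEnd ℂ ν := by
      rw [hγw]
      apply Complex.ext
      · simp [Y, h1]
      · simp [Y]
    have hν0 : starRingEnd ℂ ν ≠ 0 := right_ne_zero_of_mul_eq_one hνν
    have := mul_right_cancel₀ hν0 h2
    linear_combination this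
  have hηs₀ : η' s₀ = η s₀ := (heq.eq_of_nhdsWithin hs₀).symm
  let b : ℂ → ℝ := fun z => Real.cos (η' (γ z)) / (1 + Real.sin (η' (γ z)))
  have hη'γ : ContDiffAt ℝ 1 (fun z => η' (γ z)) s₀ := by
    refine ContDiffAt.comp s₀ (by rwa [hγ0]) (hγ.contDiffAt.of_le (by norm_num))
  have hden : ContDiffAt ℝ 1 (fun z => 1 + Real.sin (η' (γ z))) s₀ :=
    contDiffAt_const.add (Real.contDiff_sin.contDiffAt.comp s₀ hη'γ)
  have hden0 : 1 + Real.sin (η' (γ s₀)) = 2 := by rw [hγ0, hηs₀, hsin]; norm_num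
  have hb : ContDiffAt ℝ 1 b s₀ :=
    (Real.contDiff_cos.contDiffAt.comp s₀ hη'γ).div hden (by rw [hden0]; norm_num)
  have hdenpos : ∀ᶠ z in 𝓝 s₀, 1 < 1 + Real.sin (η' (γ z)) :=
    hden.continuousAt.eventually (lt_mem_nhds (by simp only [hden0]; norm_num))
  obtain ⟨B, hB, hBb⟩ := exists_contDiff_eventuallyEq hb
  -- The unit tangent of the graph, constant along `ν`; it is `C¹` because `h` is `C²`.
  let t : ℂ → ℂ := fun z => Complex.I *
    (ν * ((1 - deriv h (Y z) * Complex.I) / (Real.sqrt (1 + deriv h (Y z) ^ 2) : ℝ)))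
  have hh1 : ContDiff ℝ 1 (deriv h) := ((contDiff_succ_iff_deriv (n := 1)).1 hh).2.2
  have hd1 : ContDiff ℝ 1 fun z => deriv h (Y z) := hh1.comp (hY.of_le (by norm_num))
  have ht : ContDiff ℝ 1 t := by
    simp only [t, div_eq_mul_inv]
    refine contDiff_const.mul (contDiff_const.mul (ContDiff.mul ?_ (ContDiff.inv ?_ fun z => ?_)))
    · exact contDiff_const.sub ((Complex.ofRealCLM.contDiff.comp hd1).mul contDiff_const)
    · exact Complex.ofRealCLM.contDiff.comp
        ((contDiff_const.add (hd1.pow 2)).sqrt fun z => by positivity)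
    · have : Real.sqrt (1 + deriv h (Y z) ^ 2) ≠ 0 := (Real.sqrt_pos.2 (by positivity)).ne'
      exact_mod_cast this
  have hBs : ∀ᶠ s in 𝓝[frontier Ω] s₀, 0 < 1 + Real.sin (η s) ∧
      B s = Real.cos (η s) / (1 + Real.sin (η s)) ∧ t s = unitTangent Ω s := by
    filter_upwards [heq, hγid, nhdsWithin_le_nhds hdenpos, nhdsWithin_le_nhds hBb,
      nhdsWithin_le_nhds hball, self_mem_nhdsWithin] with s h1 h2 h3 h4 h5 h6
    rw [h2, ← h1] at h3
    refine ⟨by linarith, by rw [h4, h1]; simp only [b, h2], ?_⟩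
    -- The outward normal is a chosen one, so it has to be identified through the uniqueness of
    -- normals to a local graph.
    have h7 := hC2 s h6
    have h8 : IsOutwardNormal Ω s (outwardNormal Ω s) := by
      rw [outwardNormal, dif_pos h7]
      exact h7.choose_spec
    rw [unitTangent, h8.eq_of_isLocalGraph hΩ hν h5 (hh.differentiable (by simp) _).hasDerivAt
      (hΩ.eq_of_mem_frontier hop hh.continuous h6 h5)]
  obtain ⟨R₀, hR₀, hR₀s⟩ := Metric.mem_nhdsWithin_iff.1 hBs
  -- The denominator exceeds `1`, so `|B|` is at most `|cos η|` at `γ z`, and `γ z - s₀ = O(z -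
  -- s₀)`.
  have hbO : B =O[𝓝 s₀] fun z => ‖z - s₀‖ ^ 2 := by
    have h1 : (fun z => Real.cos (η (γ z))) =O[𝓝 s₀] fun z => ‖γ z - s₀‖ ^ 2 :=
      hcos.comp_tendsto hγf
    have h2 : (fun z => ‖γ z - s₀‖ ^ 2) =O[𝓝 s₀] fun z => ‖z - s₀‖ ^ 2 := by
      have := (hγ.differentiable (by simp) s₀).hasFDerivAt.isBigO_sub
      rw [hγ0] at this
      exact this.norm_norm.pow 2
    refine IsBigO.trans (IsBigO.of_bound 1 ?_) (h1.trans h2)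
    filter_upwards [hBb, hdenpos, hγf.eventually heq] with z h3 h4 h5
    rw [h3, h5, one_mul]
    simp only [b, norm_div, Real.norm_eq_abs]
    refine div_le_self (abs_nonneg _) ?_
    rw [abs_of_pos (by linarith)]
    exact h4.le
  refine ⟨R₀, B, t, hR₀, hB, ht, fun s hs => hR₀s ⟨hs.2, hs.1⟩, hbO.hasFDerivAt (by norm_num), ?_⟩
  have := (hBs.self_of_nhdsWithin hs₀).2.1
  rw [this, (hcos.eq_zero_of_norm_pow_within hs₀ (by norm_num)), zero_div]

/-! ### Divergence of the pole in an interior cone -/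

/-- In the plane `|z|⁻²` is not integrable over a cone at its vertex: each dyadic scale contributes
a fixed amount. A pole at distance `ε` outside still sees all scales larger than `ε`. -/
theorem exists_le_lintegral_inv_pow {Ω : Set ℂ} {p ν : ℂ} (hν : ‖ν‖ = 1) {ρ : ℝ} (hρ : 0 < ρ)
    (hρ1 : ρ ≤ 1 / 2)
    (hcone : ∀ z ∈ Metric.ball p ρ,
      ((z - p) * starRingEnd ℂ ν).re < -|((z - p) * starRingEnd ℂ ν).im| → z ∈ Ω)
    {m : ℕ} (hm : 1 ≤ m) {M : ℝ≥0∞} (hM : M ≠ ⊤) :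
    ∃ ε : ℝ, 0 < ε ∧ ε ≤ ρ ∧
      M ≤ ∫⁻ z in Ω ∩ Metric.ball p ρ, ‖((z - (p + ε * ν)) ^ m)⁻¹‖ₑ ^ 2 := by
  obtain ⟨N, hN⟩ := ENNReal.exists_nat_mul_gt (a := ENNReal.ofReal (Real.pi / 64)) (b := M)
    (by simp [Real.pi_pos]) hM
  -- Dyadic distances along the inward normal. The discs of radius `a j / 4` about `p - a j ν` are
  -- disjoint and lie in the cone; the pole is placed at `ε = a N`.
  let a : ℕ → ℝ := fun j => ρ / 2 * (1 / 2) ^ j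
  have ha : ∀ j, 0 < a j := fun j => by positivity
  have ha_anti : ∀ i j, i < j → a j ≤ a i / 2 := by
    intro i j hij
    have : ((1 : ℝ) / 2) ^ j ≤ (1 / 2) ^ (i + 1) :=
      pow_le_pow_of_le_one (by norm_num) (by norm_num) hij
    simp only [a]
    rw [pow_succ] at this
    nlinarith
  have ha1 : ∀ j, a j ≤ ρ / 2 := by
    intro j
    have : ((1 : ℝ) / 2) ^ j ≤ 1 := pow_le_one₀ (by norm_num) (by norm_num)
    simp only [a]
    nlinarith
  let S : ℕ → Set ℂ := fun j => Metric.ball (p - a j * ν) (a j / 4)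
  have haν : ∀ j, ‖(a j : ℂ) * ν‖ = a j := fun j => by
    rw [norm_mul, hν, mul_one, Complex.norm_real, Real.norm_eq_abs, abs_of_pos (ha j)]
  have hSn : ∀ j, ∀ z ∈ S j, 3 / 4 * a j < ‖z - p‖ ∧ ‖z - p‖ < 5 / 4 * a j := by
    intro j z hz
    have h1 : ‖z - (p - a j * ν)‖ < a j / 4 := by rwa [← dist_eq_norm]
    have h2 : ‖z - p‖ ≤ ‖z - (p - a j * ν)‖ + ‖(a j : ℂ) * ν‖ := by
      have := norm_sub_le (z - (p - a j * ν)) (a j * ν)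
      rwa [show z - (p - a j * ν) - a j * ν = z - p by ring] at this
    have h3 : ‖(a j : ℂ) * ν‖ ≤ ‖z - (p - a j * ν)‖ + ‖z - p‖ := by
      have := norm_sub_le (z - (p - a j * ν)) (z - p)
      rwa [show z - (p - a j * ν) - (z - p) = a j * ν by ring] at this
    rw [haν] at h2 h3
    constructor <;> linarith
  have hSball : ∀ j, S j ⊆ Metric.ball p ρ := by
    intro j z hz
    rw [Metric.mem_ball, dist_eq_norm]
    linarith [(hSn j z hz).2, ha1 j]
  have hScone : ∀ j, ∀ z ∈ S j,
      ((z - p) * starRingEnd ℂ ν).re < -|((z - p) * starRingEnd ℂ ν).im| := by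
    intro j z hz
    have h1 : ‖(z - p) * starRingEnd ℂ ν + a j‖ < a j / 4 := by
      rw [show (z - p) * starRingEnd ℂ ν + a j = (z - (p - a j * ν)) * starRingEnd ℂ ν by
        linear_combination (-(a j : ℂ)) * mul_conj_of_norm_eq_one hν, norm_mul, RCLike.norm_conj, hν,
        mul_one, ← dist_eq_norm]
      exact hz
    have h2 := (abs_le.1 ((Complex.abs_re_le_norm _).trans h1.le)).2
    have h3 := (Complex.abs_im_le_norm _).trans h1.le
    simp only [Complex.add_re, Complex.ofReal_re, Complex.add_im, Complex.ofReal_im, add_zero]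
      at h2 h3
    linarith [ha j]
  have hdisj : Set.PairwiseDisjoint (↑(Finset.range N)) S := by
    have : ∀ i j, i < j → Disjoint (S i) (S j) := by
      intro i j hij
      refine Set.disjoint_left.2 fun z hi hj => ?_
      linarith [(hSn i z hi).1, (hSn j z hj).2, ha_anti i j hij, ha i]
    intro i _ j _ hij
    rcases lt_or_gt_of_ne hij with h | h
    · exact this i j h
    · exact (this j i h).symm
  refine ⟨a N, ha N, (ha1 N).trans (by linarith), hN.le.trans ?_⟩
  have hsub : (⋃ j ∈ Finset.range N, S j) ⊆ Ω ∩ Metric.ball p ρ := by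
    refine iUnion₂_subset fun j _ z hz => ⟨?_, hSball j hz⟩
    exact hcone z (hSball j hz) (hScone j z hz)
  refine le_trans ?_ (lintegral_mono_set hsub)
  rw [lintegral_biUnion_finset hdisj fun j _ => Metric.isOpen_ball.measurableSet]
  have hterm : ∀ j ∈ Finset.range N, ENNReal.ofReal (Real.pi / 64) ≤
      ∫⁻ z in S j, ‖((z - (p + a N * ν)) ^ m)⁻¹‖ₑ ^ 2 := by
    intro j hj
    have hjN := Finset.mem_range.1 hj
    -- The distance to the pole is at most `5/4 a j + a N ≤ 2 a j ≤ 1`, so its `m`-th power is no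
    -- larger than `2 a j`. The disc has area `π (a j)² / 16`, whence the constant `π / 64`.
    have hpt : ∀ z ∈ S j, ENNReal.ofReal ((1 / (2 * a j)) ^ 2) ≤
        ‖((z - (p + a N * ν)) ^ m)⁻¹‖ₑ ^ 2 := by
      intro z hz
      rw [← ofReal_norm, ← ENNReal.ofReal_pow (norm_nonneg _)]
      refine ENNReal.ofReal_le_ofReal (pow_le_pow_left₀ (by have := ha j; positivity) ?_ 2)
      have h1 : ‖z - (p + a N * ν)‖ ≤ 2 * a j := by
        have := norm_sub_le (z - p) (a N * ν)
        rw [show z - p - a N * ν = z - (p + a N * ν) by ring, haν] at this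
        linarith [(hSn j z hz).2, ha_anti j N hjN, ha j]
      have h2 : 0 < ‖z - (p + a N * ν)‖ := by
        rw [norm_pos_iff]
        intro h0
        have h3 := hScone j z hz
        rw [show z - p = a N * ν by linear_combination h0, mul_assoc, mul_conj_of_norm_eq_one hν,
          mul_one, Complex.ofReal_re, Complex.ofReal_im, abs_zero] at h3
        linarith [ha N]
      have h4 : ‖z - (p + a N * ν)‖ ≤ 1 := by linarith [ha1 j]
      rw [norm_inv, norm_pow, one_div]
      refine inv_anti₀ (pow_pos h2 m) ?_
      calc ‖z - (p + a N * ν)‖ ^ m ≤ ‖z - (p + a N * ν)‖ ^ 1 :=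
            pow_le_pow_of_le_one h2.le h4 hm
        _ ≤ 2 * a j := by rwa [pow_one]
    calc ENNReal.ofReal (Real.pi / 64)
        = ENNReal.ofReal ((1 / (2 * a j)) ^ 2) * volume (S j) := by
          rw [Complex.volume_ball, ← ENNReal.ofReal_pow (by have := ha j; positivity),
            ← ENNReal.ofReal_coe_nnreal, NNReal.coe_real_pi, ← ENNReal.ofReal_mul (by positivity),
            ← ENNReal.ofReal_mul (by positivity)]
          congr 1
          have := (ha j).ne'
          field_simp
          norm_num
      _ = ∫⁻ _ in S j, ENNReal.ofReal ((1 / (2 * a j)) ^ 2) := by rw [setLIntegral_const]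
      _ ≤ _ := setLIntegral_mono' Metric.isOpen_ball.measurableSet hpt
  calc (N : ℝ≥0∞) * ENNReal.ofReal (Real.pi / 64)
      = ∑ _j ∈ Finset.range N, ENNReal.ofReal (Real.pi / 64) := by
        rw [Finset.sum_const, Finset.card_range, nsmul_eq_mul]
    _ ≤ _ := Finset.sum_le_sum hterm

/-! ### Spinors with explicit components -/

theorem norm_spinor_le (p q : ℂ) : ‖(!₂[p, q] : Spinor)‖ ≤ ‖p‖ + ‖q‖ := by
  rw [EuclideanSpace.norm_eq, Fin.sum_univ_two]
  refine Real.sqrt_le_iff.2 ⟨by positivity, ?_⟩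
  simp only [Matrix.cons_val_zero, Matrix.cons_val_one]
  nlinarith [norm_nonneg p, norm_nonneg q]

theorem norm_fst_le_norm_spinor (p q : ℂ) : ‖p‖ ≤ ‖(!₂[p, q] : Spinor)‖ :=
  PiLp.norm_apply_le (!₂[p, q] : Spinor) 0

/-- With partial derivatives inserted, the entries are `-2i ∂g` and `-2i ∂̄f`: the upper component
meets only the Cauchy–Riemann operator. -/
theorem diracSymbol_spinor (p₁ p₂ q₁ q₂ : ℂ) : diracSymbol !₂[p₁, p₂] !₂[q₁, q₂] =
    !₂[-Complex.I * (p₂ - Complex.I * q₂), -Complex.I * (p₁ + Complex.I * q₁)] := by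
  ext i
  fin_cases i <;> simp [diracSymbol, pauli1, pauli2, Matrix.toLpLin_apply] <;> ring

theorem spinor_eq_smul_add (p q : ℂ) :
    (!₂[p, q] : Spinor) = p • (!₂[1, 0] : Spinor) + q • (!₂[0, 1] : Spinor) := by
  ext i
  fin_cases i <;> simp

theorem fderiv_spinor {f g : ℂ → ℂ} {f' g' : ℂ →L[ℝ] ℂ} {z : ℂ} (hf : HasFDerivAt f f' z)
    (hg : HasFDerivAt g g' z) (e : ℂ) :
    fderiv ℝ (fun z => (!₂[f z, g z] : Spinor)) z e = !₂[f' e, g' e] := by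
  rw [funext fun z => spinor_eq_smul_add (f z) (g z),
    ((hf.smul_const (!₂[1, 0] : Spinor)).fun_add (hg.smul_const (!₂[0, 1] : Spinor))).fderiv]
  ext i
  fin_cases i <;> simp

theorem contDiff_spinor {f g : ℂ → ℂ} (hf : ContDiff ℝ 1 f) (hg : ContDiff ℝ 1 g) :
    ContDiff ℝ 1 fun z => (!₂[f z, g z] : Spinor) := by
  rw [funext fun z => spinor_eq_smul_add (f z) (g z)]
  exact (hf.smul contDiff_const).add (hg.smul contDiff_const)

theorem diracField_spinor {f g : ℂ → ℂ} {f' g' : ℂ →L[ℝ] ℂ} {z : ℂ} (hf : HasFDerivAt f f' z)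
    (hg : HasFDerivAt g g' z) :
    diracField (fun z => !₂[f z, g z]) z =
      !₂[-Complex.I * (g' 1 - Complex.I * g' Complex.I),
        -Complex.I * (f' 1 + Complex.I * f' Complex.I)] := by
  rw [diracField, fderiv_spinor hf hg, fderiv_spinor hf hg, diracSymbol_spinor]

/-- The combination in `f'` is kept together because it vanishes for holomorphic `f`; the lower
component is small enough for its two derivatives to be estimated separately. -/
theorem norm_diracField_spinor_le {f g : ℂ → ℂ} {f' g' : ℂ →L[ℝ] ℂ} {z : ℂ}
    (hf : HasFDerivAt f f' z) (hg : HasFDerivAt g g' z) :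
    ‖diracField (fun z => !₂[f z, g z]) z‖ ≤
      ‖g' 1‖ + ‖g' Complex.I‖ + ‖f' 1 + Complex.I * f' Complex.I‖ := by
  rw [diracField_spinor hf hg]
  refine (norm_spinor_le _ _).trans ?_
  rw [norm_mul, norm_mul, norm_neg, Complex.norm_I, one_mul, one_mul]
  gcongr
  refine (norm_sub_le _ _).trans ?_
  rw [norm_mul, Complex.norm_I, one_mul]

/-! ### The cut-off -/

/-- The norm is not smooth at `s₀`, but the cut-off is constant near that point. -/
theorem IsCutoff.contDiff_comp_norm {χ : ℝ → ℝ} (hχ : IsCutoff χ) (s₀ : ℂ) {R : ℝ} (hR : 0 < R) :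
    ContDiff ℝ ∞ fun z : ℂ => χ (‖z - s₀‖ / R) := by
  refine contDiff_iff_contDiffAt.2 fun z => ?_
  by_cases hz : z = s₀
  · refine contDiffAt_const (c := (1 : ℝ)) |>.congr_of_eventuallyEq ?_
    filter_upwards [Metric.ball_mem_nhds z (half_pos hR)] with y hy
    rw [Metric.mem_ball, hz, dist_eq_norm] at hy
    refine hχ.2.2.1 _ ?_
    rw [div_le_div_iff₀ hR two_pos]
    linarith
  · exact hχ.1.contDiffAt.comp z (((contDiffAt_id.sub contDiffAt_const).norm ℝ
      (sub_ne_zero.2 hz)).div_const R)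

theorem IsCutoff.eventuallyEq_one {χ : ℝ → ℝ} (hχ : IsCutoff χ) {s₀ z : ℂ} {R : ℝ} (hR : 0 < R)
    (hz : ‖z - s₀‖ < R / 2) : (fun z : ℂ => χ (‖z - s₀‖ / R)) =ᶠ[𝓝 z] fun _ => 1 := by
  have hc : Continuous fun z : ℂ => ‖z - s₀‖ := by fun_prop
  filter_upwards [hc.continuousAt.eventually (gt_mem_nhds hz)] with y hy
  refine hχ.2.2.1 _ ?_
  rw [div_le_div_iff₀ hR two_pos]
  linarith

theorem IsCutoff.eventuallyEq_zero {χ : ℝ → ℝ} (hχ : IsCutoff χ) {s₀ z : ℂ} {R : ℝ} (hR : 0 < R)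
    (hz : R < ‖z - s₀‖) : (fun z : ℂ => χ (‖z - s₀‖ / R)) =ᶠ[𝓝 z] fun _ => 0 := by
  have hc : Continuous fun z : ℂ => ‖z - s₀‖ := by fun_prop
  filter_upwards [hc.continuousAt.eventually (lt_mem_nhds hz)] with y hy
  refine hχ.2.2.2 _ ?_
  rw [one_le_div hR]
  exact le_of_lt hy

theorem IsCutoff.hasCompactSupport {χ : ℝ → ℝ} (hχ : IsCutoff χ) (s₀ : ℂ) {R : ℝ} (hR : 0 < R) :
    HasCompactSupport fun z : ℂ => χ (‖z - s₀‖ / R) := by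
  refine HasCompactSupport.of_support_subset_isCompact (isCompact_closedBall s₀ R) fun z hz => ?_
  by_contra h
  rw [Metric.mem_closedBall, dist_eq_norm, not_le] at h
  exact hz (hχ.eventuallyEq_zero hR h).self_of_nhds

/-! ### The explicit functions -/

/-- `χ(|z - s₀| / R) (z - c)⁻ᵐ`. -/
def weylScalar (χ : ℝ → ℝ) (s₀ c : ℂ) (R : ℝ) (m : ℕ) (z : ℂ) : ℂ :=
  (χ (‖z - s₀‖ / R) : ℂ) * ((z - c) ^ m)⁻¹

/-- The real derivative of `weylScalar`. -/
def weylScalarDeriv (χ : ℝ → ℝ) (s₀ c : ℂ) (R : ℝ) (m : ℕ) (z e : ℂ) : ℂ :=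
  (fderiv ℝ (fun z : ℂ => χ (‖z - s₀‖ / R)) z e : ℂ) * ((z - c) ^ m)⁻¹
    - m * weylScalar χ s₀ c R m z * (z - c)⁻¹ * e

theorem hasFDerivAt_weylScalar {χ : ℝ → ℝ} (hχ : IsCutoff χ) {s₀ c : ℂ} {R : ℝ} (hR : 0 < R)
    (m : ℕ) {z : ℂ} (hz : z ≠ c) :
    ∃ f' : ℂ →L[ℝ] ℂ, HasFDerivAt (weylScalar χ s₀ c R m) f' z ∧
      ∀ e, f' e = weylScalarDeriv χ s₀ c R m z e := by
  have hzc : z - c ≠ 0 := sub_ne_zero.2 hz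
  have h1 : HasFDerivAt (fun z : ℂ => ((χ (‖z - s₀‖ / R) : ℝ) : ℂ))
      (Complex.ofRealCLM.comp (fderiv ℝ (fun z : ℂ => χ (‖z - s₀‖ / R)) z)) z :=
    Complex.ofRealCLM.hasFDerivAt.comp z
      ((hχ.contDiff_comp_norm s₀ hR).differentiable (by simp) z).hasFDerivAt
  have h2 : HasDerivAt (fun z : ℂ => ((z - c) ^ m)⁻¹)
      (-(m * (z - c) ^ (m - 1) * 1) / ((z - c) ^ m) ^ 2) z :=
    (((hasDerivAt_id z).sub_const c).pow m).inv (pow_ne_zero m hzc)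
  refine ⟨_, h1.mul (h2.hasFDerivAt.restrictScalars ℝ), fun e => ?_⟩
  have h3 : -(m * (z - c) ^ (m - 1) * 1) / ((z - c) ^ m) ^ 2
      = -(m * ((z - c) ^ m)⁻¹ * (z - c)⁻¹) := by
    rcases m with _ | k
    · simp
    · rw [Nat.add_sub_cancel]
      field_simp
      ring
  simp only [h3, weylScalarDeriv, weylScalar]
  simp
  ring

/-- Away from its pole, `weylScalar` is a `C¹` function. -/
theorem contDiffAt_weylScalar {χ : ℝ → ℝ} (hχ : IsCutoff χ) {s₀ c : ℂ} {R : ℝ} (hR : 0 < R)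
    (m : ℕ) {z : ℂ} (hz : z ≠ c) : ContDiffAt ℝ 1 (weylScalar χ s₀ c R m) z := by
  refine ContDiffAt.mul ?_ ?_
  · exact Complex.ofRealCLM.contDiff.contDiffAt.comp z
      ((hχ.contDiff_comp_norm s₀ hR).contDiffAt.of_le (by simp))
  · exact ((contDiffAt_id.sub contDiffAt_const).pow m).inv (pow_ne_zero m (sub_ne_zero.2 hz))

/-- `weylScalar` can be changed away from `closure Ω` to remove its pole. -/
theorem exists_contDiff_eq_weylScalar {χ : ℝ → ℝ} (hχ : IsCutoff χ) {s₀ c : ℂ} {R : ℝ} (hR : 0 < R)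
    (m : ℕ) {S : Set ℂ} (hc : c ∉ closure S) :
    ∃ f : ℂ → ℂ, ContDiff ℝ 1 f ∧ HasCompactSupport f ∧
      ∀ z ∈ closure S, f z = weylScalar χ s₀ c R m z := by
  obtain ⟨r, hr, hrS⟩ := Metric.isOpen_iff.1 isClosed_closure.isOpen_compl c hc
  -- Multiplication by `1 - ψ` removes the pole; `ψ` vanishes outside the ball of radius `r / 2`,
  -- hence on `closure S`.
  let ψ : ContDiffBump c := ⟨r / 4, r / 2, by positivity, by linarith⟩
  refine ⟨fun z => ((1 - ψ z : ℝ) : ℂ) * weylScalar χ s₀ c R m z,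
    contDiff_iff_contDiffAt.2 fun z => ?_, ?_, fun z hz => ?_⟩
  · by_cases hz : z = c
    · refine contDiffAt_const (c := (0 : ℂ)) |>.congr_of_eventuallyEq ?_
      rw [hz]
      filter_upwards [ψ.eventuallyEq_one] with y hy
      rw [hy, Pi.one_apply, sub_self, Complex.ofReal_zero, zero_mul]
    · exact (Complex.ofRealCLM.contDiff.contDiffAt.comp z
        (contDiffAt_const.sub ψ.contDiff.contDiffAt)).mul (contDiffAt_weylScalar hχ hR m hz)
  · have h1 : HasCompactSupport fun z : ℂ => ((χ (‖z - s₀‖ / R) : ℝ) : ℂ) :=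
      (hχ.hasCompactSupport s₀ hR).comp_left (g := fun x : ℝ => (x : ℂ)) Complex.ofReal_zero
    exact (h1.mul_right (f' := fun z => ((z - c) ^ m)⁻¹)).mul_left
  · have : ψ z = 0 := by
      refine ψ.zero_of_le_dist ?_
      by_contra! hlt
      have : z ∈ Metric.ball c r := by
        rw [Metric.mem_ball]
        exact hlt.trans (by change r / 2 < r; linarith)
      exact hrS this hz
    simp only [this]
    rw [sub_zero, Complex.ofReal_one, one_mul]

/-- The cut-off varies only where `|z - s₀| ≥ R / 2`, hence `|z - c| ≥ R / 4`. The bound does not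
depend on how close the pole is, which allows `ε` to be chosen last. -/
theorem norm_fderiv_cutoff_mul_le {χ : ℝ → ℝ} (hχ : IsCutoff χ) {s₀ c z : ℂ} {R L : ℝ} (hR : 0 < R)
    (m : ℕ) (hL : ‖fderiv ℝ (fun z : ℂ => χ (‖z - s₀‖ / R)) z‖ ≤ L)
    (hz : ‖z - s₀‖ ≤ 2 * ‖z - c‖) {e : ℂ} (he : ‖e‖ = 1) :
    ‖(fderiv ℝ (fun z : ℂ => χ (‖z - s₀‖ / R)) z e : ℂ) * ((z - c) ^ m)⁻¹‖ ≤ L * (4 / R) ^ m := by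
  have hL0 : 0 ≤ L := (norm_nonneg _).trans hL
  rcases lt_or_ge ‖z - s₀‖ (R / 2) with h | h
  · rw [(hχ.eventuallyEq_one hR h).fderiv_eq]
    simp only [fderiv_fun_const, Pi.zero_apply, zero_apply, Complex.ofReal_zero, zero_mul, norm_zero]
    positivity
  · rw [norm_mul, Complex.norm_real, norm_inv, norm_pow]
    refine mul_le_mul ?_ ?_ (by positivity) hL0
    · refine (ContinuousLinearMap.le_opNorm _ _).trans ?_
      rwa [he, mul_one]
    · rw [← inv_pow]
      refine pow_le_pow_left₀ (by positivity) ?_ m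
      rw [show 4 / R = (R / 4)⁻¹ by rw [inv_div]]
      exact inv_anti₀ (by positivity) (by linarith)

theorem norm_weylScalarDeriv_add_le {χ : ℝ → ℝ} (hχ : IsCutoff χ) {s₀ c z : ℂ} {R L : ℝ}
    (hR : 0 < R) (m : ℕ) (hL : ‖fderiv ℝ (fun z : ℂ => χ (‖z - s₀‖ / R)) z‖ ≤ L)
    (hz : ‖z - s₀‖ ≤ 2 * ‖z - c‖) {e : ℂ} (he : ‖e‖ = 1) :
    ‖weylScalarDeriv χ s₀ c R m z e + m * weylScalar χ s₀ c R m z * (z - c)⁻¹ * e‖ ≤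
      L * (4 / R) ^ m := by
  rw [weylScalarDeriv, sub_add_cancel]
  exact norm_fderiv_cutoff_mul_le hχ hR m hL hz he

/-- The Dirac operator is small on `(f, f F)`, `f` the cut-off pole. -/
theorem norm_diracField_weyl_le {χ : ℝ → ℝ} (hχ : IsCutoff χ) {s₀ c z : ℂ} {R L δ : ℝ} (hR : 0 < R)
    (m : ℕ) (hL : ‖fderiv ℝ (fun z : ℂ => χ (‖z - s₀‖ / R)) z‖ ≤ L)
    (hz : ‖z - s₀‖ ≤ 2 * ‖z - c‖) (hzc : z ≠ c) {F : ℂ → ℂ} {F' : ℂ →L[ℝ] ℂ}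
    (hF : HasFDerivAt F F' z) (hF' : ‖F'‖ ≤ δ) (hFδ : ‖F z‖ ≤ δ * ‖z - s₀‖) (hF1 : ‖F z‖ ≤ 1) :
    ‖diracField (fun z => !₂[weylScalar χ s₀ c R m z, weylScalar χ s₀ c R m z * F z]) z‖ ≤
      (4 * m + 2) * δ * ‖weylScalar χ s₀ c R m z‖ + 4 * (L * (4 / R) ^ m) := by
  obtain ⟨f', hf, hf'⟩ := hasFDerivAt_weylScalar hχ hR m hzc
  set w := weylScalar χ s₀ c R m z with hw
  set K := L * (4 / R) ^ m
  have hδ : 0 ≤ δ := (norm_nonneg _).trans hF'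
  have hK : 0 ≤ K := by have : 0 ≤ L := (norm_nonneg _).trans hL; positivity
  have hzc0 : 0 < ‖z - c‖ := norm_pos_iff.2 (sub_ne_zero.2 hzc)
  have hcomp : ∀ e : ℂ, ‖e‖ = 1 →
      ‖(w • F' + F z • f') e‖ ≤ (2 * m + 1) * δ * ‖w‖ + K := by
    intro e he
    have h1 := norm_weylScalarDeriv_add_le hχ hR m hL hz he
    rw [← hw, ← hf' e] at h1
    -- Product rule, with the derivative of the pole split off from that of the cut-off.
    have e1 : (w • F' + F z • f') e =
        w * F' e + F z * (f' e + m * w * (z - c)⁻¹ * e) - m * w * e * (F z * (z - c)⁻¹) := by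
      simp
      ring
    rw [e1]
    -- The zero of `F` at `s₀` compensates the extra power of the pole at `c`.
    have h2 : ‖F z * (z - c)⁻¹‖ ≤ 2 * δ := by
      rw [norm_mul, norm_inv, ← div_eq_mul_inv, div_le_iff₀ hzc0]
      calc ‖F z‖ ≤ δ * ‖z - s₀‖ := hFδ
        _ ≤ δ * (2 * ‖z - c‖) := by gcongr
        _ = _ := by ring
    have h3 : ‖F' e‖ ≤ δ := by
      refine (F'.le_opNorm e).trans ?_
      rwa [he, mul_one]
    calc _ ≤ ‖w * F' e‖ + ‖F z * (f' e + m * w * (z - c)⁻¹ * e)‖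
          + ‖m * w * e * (F z * (z - c)⁻¹)‖ :=
          (norm_sub_le _ _).trans (by gcongr; exact norm_add_le _ _)
      _ ≤ ‖w‖ * δ + 1 * K + m * ‖w‖ * (2 * δ) := by
          have h4 : ‖(m : ℂ) * w * e‖ = m * ‖w‖ := by
            rw [norm_mul, norm_mul, he, mul_one, Complex.norm_natCast]
          rw [norm_mul w, norm_mul (F z), norm_mul (m * w * e), h4]
          gcongr
      _ = _ := by ring
  -- The holomorphic parts of the two derivatives cancel since `1 + i · i = 0`; only cut-off terms
  -- remain.
  have hanti : ‖f' 1 + Complex.I * f' Complex.I‖ ≤ 2 * K := by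
    have h1 := norm_weylScalarDeriv_add_le hχ hR m hL hz norm_one
    have h2 := norm_weylScalarDeriv_add_le hχ hR m hL hz Complex.norm_I
    rw [← hw, ← hf'] at h1 h2
    rw [show f' 1 + Complex.I * f' Complex.I = (f' 1 + m * w * (z - c)⁻¹ * 1)
        + Complex.I * (f' Complex.I + m * w * (z - c)⁻¹ * Complex.I) by
      linear_combination (-(m * w * (z - c)⁻¹)) * Complex.I_mul_I]
    refine (norm_add_le _ _).trans ?_
    rw [norm_mul Complex.I, Complex.norm_I, one_mul]
    linarith
  refine (norm_diracField_spinor_le hf (hf.mul hF)).trans ?_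
  linarith [hcomp 1 norm_one, hcomp Complex.I Complex.norm_I]

/-- The derivative of the cut-off pole is large. -/
theorem norm_weylScalar_le {χ : ℝ → ℝ} (hχ : IsCutoff χ) {s₀ c z : ℂ} {R L : ℝ} (hR : 0 < R)
    (m : ℕ) (hL : ‖fderiv ℝ (fun z : ℂ => χ (‖z - s₀‖ / R)) z‖ ≤ L)
    (hz : ‖z - s₀‖ ≤ 2 * ‖z - c‖) (hzc : z ≠ c) (hz2 : ‖z - c‖ ≤ 2) :
    m * ‖weylScalar χ s₀ c R m z‖ ≤ 2 * (‖weylScalarDeriv χ s₀ c R m z 1‖ + L * (4 / R) ^ m) := by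
  have hzc0 : 0 < ‖z - c‖ := norm_pos_iff.2 (sub_ne_zero.2 hzc)
  have h1 := norm_weylScalarDeriv_add_le hχ hR m hL hz norm_one
  set w := weylScalar χ s₀ c R m z
  set d := weylScalarDeriv χ s₀ c R m z 1
  have h2 : ‖m * w * (z - c)⁻¹ * 1‖ ≤ ‖d‖ + L * (4 / R) ^ m := by
    have := norm_sub_le (d + m * w * (z - c)⁻¹ * 1) d
    rw [add_sub_cancel_left] at this
    linarith
  have h3 : ‖m * w * (z - c)⁻¹ * 1‖ * ‖z - c‖ = m * ‖w‖ := by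
    rw [mul_one, norm_mul, norm_mul, norm_inv, Complex.norm_natCast, mul_assoc,
      inv_mul_cancel₀ hzc0.ne', mul_one]
  rw [← h3]
  calc _ ≤ (‖d‖ + L * (4 / R) ^ m) * 2 := by
        refine mul_le_mul h2 hz2 hzc0.le ((norm_nonneg _).trans h2)
    _ = _ := by ring

/-- The norm in `L²(Ω, ℂ²)`. -/
def l2norm (Ω : Set ℂ) (φ : ℂ → Spinor) : ℝ := (eLpNorm φ 2 (volume.restrict Ω)).toReal

theorem norm_classL2 (Ω : Set ℂ) {f : ℂ → Spinor} (hf : Continuous f) (hc : HasCompactSupport f) :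
    ‖classL2 Ω hf hc‖ = l2norm Ω f :=
  Lp.norm_toLp _ _

theorem l2norm_congr_norm {Ω : Set ℂ} {f g : ℂ → Spinor} (h : ∀ z, ‖f z‖ = ‖g z‖) :
    l2norm Ω f = l2norm Ω g := by
  rw [l2norm, l2norm, eLpNorm_congr_norm_ae (Eventually.of_forall h)]

theorem l2norm_le_of_le_add {Ω : Set ℂ} (hop : IsOpen Ω) (hvol : volume Ω ≠ ⊤) {f g : ℂ → Spinor}
    (hf : Continuous f) (hfc : HasCompactSupport f) (hg : Continuous g) (hgc : HasCompactSupport g)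
    {a K : ℝ} (ha : 0 ≤ a) (hK : 0 ≤ K) (h : ∀ z ∈ Ω, ‖f z‖ ≤ a * ‖g z‖ + K) :
    l2norm Ω f ≤ a * l2norm Ω g + K * ((volume Ω) ^ (1 / 2 : ℝ)).toReal := by
  rw [← norm_classL2 Ω hf hfc, ← norm_classL2 Ω hg hgc]
  refine norm_le_of_ae_le_add hvol ha hK ?_
  filter_upwards [coeFn_classL2 Ω hf hfc, coeFn_classL2 Ω hg hgc,
    ae_restrict_mem hop.measurableSet] with z h1 h2 h3
  rw [h1, h2]
  exact h z h3

theorem le_l2norm {Ω : Set ℂ} {f : ℂ → Spinor} (hf : Continuous f) (hfc : HasCompactSupport f)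
    {M : ℝ} (hM : ENNReal.ofReal M ^ 2 ≤ ∫⁻ z in Ω, ‖f z‖ₑ ^ 2) : M ≤ l2norm Ω f := by
  have h1 := eLpNorm_nnreal_pow_eq_lintegral (f := f) (μ := volume.restrict Ω) (p := 2) two_ne_zero
  have h2 : eLpNorm f 2 (volume.restrict Ω) ^ 2 = ∫⁻ z in Ω, ‖f z‖ₑ ^ 2 := by
    simpa using h1
  rw [← h2] at hM
  have h3 : ENNReal.ofReal M ≤ eLpNorm f 2 (volume.restrict Ω) :=
    (ENNReal.pow_le_pow_left_iff two_ne_zero).1 hM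
  have h4 : eLpNorm f 2 (volume.restrict Ω) ≠ ⊤ :=
    ((hf.memLp_of_hasCompactSupport hfc).restrict Ω).eLpNorm_ne_top
  exact (ENNReal.ofReal_le_iff_le_toReal h4).1 h3

/-- `φ` is almost annihilated by `T`, and its derivative is large. -/
def IsWeylProfile (Ω : Set ℂ) (m : ℕ) (φ : ℂ → Spinor) : Prop :=
  0 < l2norm Ω φ ∧ l2norm Ω (diracField φ) ≤ l2norm Ω φ / m ∧
    m * l2norm Ω φ ≤ 8 * l2norm Ω (fun z => fderiv ℝ φ z 1)

/-- For a suitable radius `R` and a pole `s₀ + ε ν` close to `s₀`, the spinor `(f, f F)` with `f` the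
cut-off pole of order `m` is a Weyl profile. -/
theorem exists_isWeylProfile {Ω : Set ℂ} (hop : IsOpen Ω) (hvol : volume Ω ≠ ⊤) {s₀ ν : ℂ}
    (hν : IsOutwardNormal Ω s₀ ν) {F : ℂ → ℂ} (hF : ContDiff ℝ 1 F) (hF0 : F s₀ = 0)
    (hF' : HasFDerivAt F (0 : ℂ →L[ℝ] ℂ) s₀) {χ : ℝ → ℝ} (hχ : IsCutoff χ) {R₁ : ℝ} (hR₁ : 0 < R₁)
    {m : ℕ} (hm : 1 ≤ m) :
    ∃ (R ε : ℝ) (f : ℂ → ℂ), 0 < R ∧ R ≤ R₁ ∧ 0 < ε ∧ ContDiff ℝ 1 f ∧ HasCompactSupport f ∧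
      (∀ z ∈ closure Ω, f z = weylScalar χ s₀ (s₀ + ε * ν) R m z) ∧
      IsWeylProfile Ω m fun z => !₂[f z, f z * F z] := by
  have hm0 : (1 : ℝ) ≤ m := by exact_mod_cast hm
  obtain ⟨ρ₀, hρ₀, hcone, hnt⟩ := hν.exists_cone
  have hν1 := hν.1
  -- Chosen so that `(4m + 2) δ = 1 / (2m)`: half of the allowed error `1 / m`, the other half being
  -- left for the cut-off.
  set δ : ℝ := 1 / (2 * m * (4 * m + 2)) with hδ
  have hδ0 : 0 < δ := by positivity
  have hδm : (4 * m + 2) * δ = 1 / (2 * m) := by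
    rw [hδ]
    field_simp
  have hδ1 : δ ≤ 1 := by
    rw [hδ, div_le_one (by positivity)]
    nlinarith
  have hFs : ∀ᶠ z in 𝓝 s₀, ‖fderiv ℝ F z‖ ≤ δ ∧ ‖F z‖ ≤ δ * ‖z - s₀‖ := by
    have h1 : Tendsto (fun z => ‖fderiv ℝ F z‖) (𝓝 s₀) (𝓝 0) := by
      have := ((hF.continuous_fderiv (by simp)).norm.tendsto s₀)
      rwa [hF'.fderiv, norm_zero] at this
    have h2 := hF'.isLittleO.def hδ0
    filter_upwards [h1.eventually (gt_mem_nhds hδ0), h2] with z h3 h4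
    refine ⟨h3.le, ?_⟩
    simpa [hF0] using h4
  obtain ⟨ρ₁, hρ₁, hFρ⟩ := Metric.eventually_nhds_iff_ball.1 hFs
  set ρ : ℝ := min (min ρ₀ ρ₁) 1
  have hρ : 0 < ρ := by positivity
  have hρρ₀ : ρ ≤ ρ₀ := (min_le_left _ _).trans (min_le_left _ _)
  have hρρ₁ : ρ ≤ ρ₁ := (min_le_left _ _).trans (min_le_right _ _)
  have hρ1 : ρ ≤ 1 := min_le_right _ _
  -- The support of the cut-off stays inside the ball of radius `ρ`, where the cone condition and
  -- the bounds on `F` hold.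
  set R : ℝ := min R₁ (ρ / 2)
  have hR : 0 < R := by positivity
  have hRρ : R ≤ ρ / 2 := min_le_right _ _
  have hX := (hχ.contDiff_comp_norm s₀ hR)
  obtain ⟨L, hL⟩ : ∃ L, ∀ z, ‖fderiv ℝ (fun z : ℂ => χ (‖z - s₀‖ / R)) z‖ ≤ L :=
    (hX.continuous_fderiv (by simp)).bounded_above_of_compact_support
      ((hχ.hasCompactSupport s₀ hR).fderiv ℝ)
  have hL0 : 0 ≤ L := (norm_nonneg _).trans (hL 0)
  set K : ℝ := L * (4 / R) ^ m
  have hK : 0 ≤ K := by positivity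
  set V : ℝ := ((volume Ω) ^ (1 / 2 : ℝ)).toReal
  have hV : 0 ≤ V := ENNReal.toReal_nonneg
  -- `K` and `V` do not involve `ε`. A norm of at least `8 m K V` keeps the cut-off term `4 K V`
  -- below `‖φ‖ / (2m)`; the `1` ensures positivity.
  set M : ℝ := max 1 (8 * m * (K * V))
  obtain ⟨ε, hε, hεR, hM⟩ := exists_le_lintegral_inv_pow (Ω := Ω) hν1 (half_pos hR)
    (by linarith) (fun z hz => hcone z (Metric.ball_subset_ball (by linarith) hz)) hm
    (M := ENNReal.ofReal M ^ 2) (by simp)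
  set c : ℂ := s₀ + ε * ν with hc
  have hcs : ‖c - s₀‖ = ε := by
    rw [hc, add_sub_cancel_left, norm_mul, hν1, mul_one, Complex.norm_real, Real.norm_eq_abs,
      abs_of_pos hε]
  -- At `z = c` the inequality `|z - s₀| ≤ 2 |z - c|` would read `ε ≤ 0`.
  have hcΩ : c ∉ closure Ω := by
    intro h
    have h1 := hnt c ⟨h, by rw [Metric.mem_ball, dist_eq_norm, hcs]; linarith⟩ ε hε.le
    rw [hcs, ← hc, sub_self, norm_zero, mul_zero] at h1
    linarith
  obtain ⟨f, hf, hfc, hfw⟩ := exists_contDiff_eq_weylScalar hχ (s₀ := s₀) hR m hcΩ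
  have hg : ContDiff ℝ 1 fun z => f z * F z := hf.mul hF
  let φ : ℂ → Spinor := fun z => !₂[f z, f z * F z]
  have hφ : ContDiff ℝ 1 φ := contDiff_spinor hf hg
  have hφc : HasCompactSupport φ := hfc.mono' fun z hz => by
    by_contra h
    have : f z = 0 := image_eq_zero_of_notMem_tsupport h
    exact hz (by ext i; fin_cases i <;> simp [φ, this])
  have hd : Continuous fun z => fderiv ℝ φ z 1 :=
    (hφ.continuous_fderiv (by simp)).clm_apply continuous_const
  have hdc : HasCompactSupport fun z => fderiv ℝ φ z 1 := hφc.fderiv_apply ℝ 1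
  -- The explicit spinor with its pole; it agrees with `φ` near each point of `Ω`, so pointwise
  -- estimates may use it.
  let φw : ℂ → Spinor := fun z => !₂[weylScalar χ s₀ c R m z, weylScalar χ s₀ c R m z * F z]
  have hev : ∀ z ∈ Ω, φ =ᶠ[𝓝 z] φw := by
    intro z hz
    filter_upwards [hop.mem_nhds hz] with y hy
    simp only [φ, φw, hfw y (subset_closure hy)]
  have hdirac : ∀ z ∈ Ω, diracField φ z = diracField φw z := fun z hz => by
    rw [diracField, diracField, (hev z hz).fderiv_eq]
  have hfar : ∀ z ∈ Ω, ρ ≤ ‖z - s₀‖ → φ =ᶠ[𝓝 z] fun _ => 0 := by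
    intro z hz hρz
    filter_upwards [hev z hz, hχ.eventuallyEq_zero (s₀ := s₀) hR (by linarith)] with y h1 h2
    rw [h1]
    ext i
    fin_cases i <;> simp [φw, weylScalar, h2]
  have hnear : ∀ z ∈ Ω, ‖z - s₀‖ < ρ → ‖z - s₀‖ ≤ 2 * ‖z - c‖ ∧ z ≠ c ∧ ‖fderiv ℝ F z‖ ≤ δ ∧
      ‖F z‖ ≤ δ * ‖z - s₀‖ ∧ ‖F z‖ ≤ 1 := by
    intro z hz hρz
    have h1 : z ∈ Metric.ball s₀ ρ := by rwa [Metric.mem_ball, dist_eq_norm]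
    have h2 := hFρ z (Metric.ball_subset_ball hρρ₁ h1)
    refine ⟨hnt z ⟨subset_closure hz, Metric.ball_subset_ball hρρ₀ h1⟩ ε hε.le,
      fun h => hcΩ (h ▸ subset_closure hz), h2.1, h2.2, h2.2.trans ?_⟩
    exact mul_le_one₀ hδ1 (norm_nonneg _) (by linarith)
  have hT : l2norm Ω (diracField φ) ≤ (4 * m + 2) * δ * l2norm Ω φ + 4 * K * V := by
    refine l2norm_le_of_le_add hop hvol (continuous_diracField hφ) (hasCompactSupport_diracField hφc)
      hφ.continuous hφc (by positivity) (by positivity) fun z hz => ?_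
    rcases lt_or_ge ‖z - s₀‖ ρ with h | h
    · obtain ⟨h1, h2, h3, h4, h5⟩ := hnear z hz h
      rw [hdirac z hz]
      refine (norm_diracField_weyl_le hχ hR m (hL z) h1 h2
        (hF.differentiable (by simp) z).hasFDerivAt h3 h4 h5).trans ?_
      rw [(hev z hz).self_of_nhds]
      gcongr
      exact norm_fst_le_norm_spinor _ _
    · have h0 : diracField φ z = 0 := by
        rw [diracField, (hfar z hz h).fderiv_eq]
        simp [diracSymbol]
      rw [h0, norm_zero]
      positivity
  have hD : l2norm Ω φ ≤ 4 / m * l2norm Ω (fun z => fderiv ℝ φ z 1) + 4 / m * K * V := by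
    refine l2norm_le_of_le_add hop hvol hφ.continuous hφc hd hdc (by positivity) (by positivity)
      fun z hz => ?_
    rcases lt_or_ge ‖z - s₀‖ ρ with h | h
    · obtain ⟨h1, h2, h3, h4, h5⟩ := hnear z hz h
      have hzc2 : ‖z - c‖ ≤ 2 := by
        have := norm_sub_le (z - s₀) (c - s₀)
        rw [sub_sub_sub_cancel_right, hcs] at this
        linarith
      have h6 := norm_weylScalar_le hχ hR m (hL z) h1 h2 hzc2
      obtain ⟨f', hf1, hf2⟩ := hasFDerivAt_weylScalar hχ (s₀ := s₀) hR m h2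
      have h7 : ‖weylScalarDeriv χ s₀ c R m z 1‖ ≤ ‖fderiv ℝ φ z 1‖ := by
        have e1 : fderiv ℝ φw z 1 = _ :=
          fderiv_spinor hf1 (hf1.mul (hF.differentiable (by simp) z).hasFDerivAt) 1
        rw [(hev z hz).fderiv_eq, e1, ← hf2]
        exact norm_fst_le_norm_spinor _ _
      have h8 : ‖φ z‖ ≤ 2 * ‖weylScalar χ s₀ c R m z‖ := by
        rw [(hev z hz).self_of_nhds]
        refine (norm_spinor_le _ _).trans ?_
        rw [norm_mul]
        nlinarith [norm_nonneg (weylScalar χ s₀ c R m z)]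
      rw [← mul_add, div_mul_eq_mul_div, le_div_iff₀ (by positivity)]
      calc ‖φ z‖ * m ≤ 2 * (m * ‖weylScalar χ s₀ c R m z‖) := by nlinarith
        _ ≤ 2 * (2 * (‖weylScalarDeriv χ s₀ c R m z 1‖ + K)) := by gcongr
        _ ≤ 2 * (2 * (‖fderiv ℝ φ z 1‖ + K)) := by gcongr
        _ = _ := by ring
    · rw [(hfar z hz h).self_of_nhds, norm_zero]
      positivity
  have hφM : M ≤ l2norm Ω φ := by
    refine le_l2norm hφ.continuous hφc (hM.trans ?_)
    refine le_trans ?_ (lintegral_mono_set (inter_subset_left (t := Metric.ball s₀ (R / 2))))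
    refine setLIntegral_mono' (hop.inter Metric.isOpen_ball).measurableSet fun z hz => ?_
    gcongr ?_ ^ 2
    rw [enorm_le_iff_norm_le, (hev z hz.1).self_of_nhds]
    refine le_trans (le_of_eq ?_) (norm_fst_le_norm_spinor _ _)
    have hz2 : ‖z - s₀‖ < R / 2 := by rw [← dist_eq_norm]; exact hz.2
    have : χ (‖z - s₀‖ / R) = 1 := (hχ.eventuallyEq_one hR hz2).self_of_nhds
    rw [weylScalar, this, Complex.ofReal_one, one_mul]
  have hM1 : 1 ≤ l2norm Ω φ := (le_max_left _ _).trans hφM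
  have hMK : 8 * m * (K * V) ≤ l2norm Ω φ := (le_max_right _ _).trans hφM
  refine ⟨R, ε, f, hR, min_le_left _ _, hε, hf, hfc, hfw, by linarith, ?_, ?_⟩
  · refine hT.trans ?_
    rw [hδm, le_div_iff₀ (by positivity)]
    have e1 : 1 / (2 * m) * l2norm Ω φ * m = l2norm Ω φ / 2 := by field_simp
    nlinarith
  · have h1 : m * l2norm Ω φ ≤ 4 * l2norm Ω (fun z => fderiv ℝ φ z 1) + 4 * (K * V) := by
      calc m * l2norm Ω φ ≤
          m * (4 / m * l2norm Ω (fun z => fderiv ℝ φ z 1) + 4 / m * K * V) := by gcongr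
        _ = _ := by field_simp
    -- By the choice of `M`, the error `4 K V` is at most `‖φ‖ / 2 ≤ m ‖φ‖ / 2` and is absorbed on
    -- the left, turning the constant `4` into `8`.
    have h2 : 8 * (K * V) ≤ 8 * m * (K * V) := by nlinarith [mul_nonneg hK hV]
    nlinarith

/-- The charge conjugation `(p, q) ↦ (q̄, p̄)`. -/
theorem IsWeylProfile.conj {Ω : Set ℂ} {m : ℕ} {f g : ℂ → ℂ} (hf : ContDiff ℝ 1 f)
    (hg : ContDiff ℝ 1 g) (h : IsWeylProfile Ω m fun z => !₂[f z, g z]) :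
    IsWeylProfile Ω m fun z => !₂[starRingEnd ℂ (g z), starRingEnd ℂ (f z)] := by
  have hn : ∀ p q : ℂ, ‖(!₂[p, q] : Spinor)‖ = ‖(!₂[starRingEnd ℂ q, starRingEnd ℂ p] : Spinor)‖ := by
    intro p q
    rw [EuclideanSpace.norm_eq, EuclideanSpace.norm_eq, Fin.sum_univ_two, Fin.sum_univ_two]
    simp [add_comm]
  have hfd : ∀ z, HasFDerivAt f (fderiv ℝ f z) z := fun z =>
    (hf.differentiable (by simp) z).hasFDerivAt
  have hgd : ∀ z, HasFDerivAt g (fderiv ℝ g z) z := fun z =>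
    (hg.differentiable (by simp) z).hasFDerivAt
  have hcd : ∀ {k : ℂ → ℂ} {k' : ℂ →L[ℝ] ℂ} {z : ℂ}, HasFDerivAt k k' z →
      HasFDerivAt (fun z => starRingEnd ℂ (k z)) ((Complex.conjCLE : ℂ →L[ℝ] ℂ).comp k') z :=
    fun hk => (Complex.conjCLE : ℂ →L[ℝ] ℂ).hasFDerivAt.comp _ hk
  have e0 : l2norm Ω (fun z => !₂[f z, g z]) =
      l2norm Ω (fun z => !₂[starRingEnd ℂ (g z), starRingEnd ℂ (f z)]) :=
    l2norm_congr_norm fun z => hn _ _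
  -- Conjugation exchanges `∂` and `∂̄`, so the Dirac field is itself conjugated and swapped, up to
  -- a sign.
  have e1 : l2norm Ω (diracField fun z => !₂[f z, g z]) =
      l2norm Ω (diracField fun z => !₂[starRingEnd ℂ (g z), starRingEnd ℂ (f z)]) := by
    refine l2norm_congr_norm fun z => ?_
    rw [diracField_spinor (hfd z) (hgd z), diracField_spinor (hcd (hgd z)) (hcd (hfd z)), hn,
      ← norm_neg]
    congr 1
    ext i
    fin_cases i <;> simp [sub_eq_add_neg]
  have e2 : l2norm Ω (fun z => fderiv ℝ (fun z => (!₂[f z, g z] : Spinor)) z 1) =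
      l2norm Ω (fun z =>
        fderiv ℝ (fun z => (!₂[starRingEnd ℂ (g z), starRingEnd ℂ (f z)] : Spinor)) z 1) := by
    refine l2norm_congr_norm fun z => ?_
    rw [fderiv_spinor (hfd z) (hgd z), fderiv_spinor (hcd (hgd z)) (hcd (hfd z)), hn]
    rfl
  rwa [IsWeylProfile, e0, e1, e2] at h

/-! ### The boundary condition -/

theorem norm_unitTangent {Ω : Set ℂ} (hC2 : HasC2Boundary Ω) {s : ℂ} (hs : s ∈ frontier Ω) :
    unitTangent Ω s * starRingEnd ℂ (unitTangent Ω s) = 1 := by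
  have h := hC2 s hs
  refine mul_conj_of_norm_eq_one ?_
  rw [unitTangent, norm_mul, Complex.norm_I, one_mul, outwardNormal, dif_pos h]
  exact h.choose_spec.1

theorem projMinus_spinor (η : ℝ) (t p q : ℂ) :
    Matrix.toEuclideanLin (projMinus η t) !₂[p, q] =
      !₂[(p - (Real.sin η * p + Real.cos η * starRingEnd ℂ t * q)) / 2,
        (q - (Real.cos η * t * p - Real.sin η * q)) / 2] := by
  have ht : starRingEnd ℂ t = t.re - t.im * Complex.I := by
    apply Complex.ext <;> simp
  have ht' : t = t.re + t.im * Complex.I := (Complex.re_add_im t).symm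
  ext i
  fin_cases i
  · simp [projMinus, boundaryMatrix, pauli1, pauli2, pauli3, Matrix.toLpLin_apply,
      ht]
    ring
  · simp [projMinus, boundaryMatrix, pauli1, pauli2, pauli3, Matrix.toLpLin_apply]
    ring

/-- With `|t| = 1` the two rows reduce to `B (1 + sin η) = cos η` and `B cos η = 1 - sin η`. This
form of `B` remains meaningful where `cos η = 0`. -/
theorem projMinus_eq_zero {η B : ℝ} {t : ℂ} (ht : t * starRingEnd ℂ t = 1)
    (hη : 0 < 1 + Real.sin η) (hB : B = Real.cos η / (1 + Real.sin η)) (p : ℂ) :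
    Matrix.toEuclideanLin (projMinus η t) !₂[p, p * (B * t)] = 0 := by
  have h1 : B * (1 + Real.sin η) = Real.cos η := by rw [hB, div_mul_cancel₀ _ hη.ne']
  have h2 : Real.cos η * B = 1 - Real.sin η := by
    rw [hB, mul_div_assoc', div_eq_iff hη.ne']
    linear_combination Real.sin_sq_add_cos_sq η
  have h1' : (B : ℂ) * (1 + Real.sin η) = Real.cos η := by exact_mod_cast h1
  have h2' : (Real.cos η : ℂ) * B = 1 - Real.sin η := by exact_mod_cast h2
  rw [projMinus_spinor]
  ext i
  fin_cases i
  · change (p - (Real.sin η * p + Real.cos η * starRingEnd ℂ t * (p * (B * t)))) / 2 = 0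
    linear_combination (-(p / 2 * Real.cos η * B)) * ht - p / 2 * h2'
  · change (p * (B * t) - (Real.cos η * t * p - Real.sin η * (p * (B * t)))) / 2 = 0
    linear_combination (p * t / 2) * h1'

/-- Charge conjugation carries the boundary condition for `-η` to the one for `η`. -/
theorem projMinus_conj_eq_zero {η B : ℝ} {t : ℂ} (ht : t * starRingEnd ℂ t = 1)
    (hη : 0 < 1 + Real.sin (-η)) (hB : B = Real.cos (-η) / (1 + Real.sin (-η))) (p : ℂ) :
    Matrix.toEuclideanLin (projMinus η t)
      !₂[starRingEnd ℂ (p * (B * t)), starRingEnd ℂ p] = 0 := by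
  rw [Real.sin_neg, Real.cos_neg] at *
  have h1 : B * (1 + -Real.sin η) = Real.cos η := by rw [hB, div_mul_cancel₀ _ hη.ne']
  have h2 : Real.cos η * B = 1 + Real.sin η := by
    rw [hB, mul_div_assoc', div_eq_iff hη.ne']
    linear_combination Real.sin_sq_add_cos_sq η
  have h1' : (B : ℂ) * (1 + -Real.sin η) = Real.cos η := by exact_mod_cast h1
  have h2' : (Real.cos η : ℂ) * B = 1 + Real.sin η := by exact_mod_cast h2
  rw [projMinus_spinor, map_mul, map_mul, Complex.conj_ofReal]
  set q := starRingEnd ℂ p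
  set τ := starRingEnd ℂ t
  ext i
  fin_cases i
  · change (q * (B * τ) - (Real.sin η * (q * (B * τ)) + Real.cos η * τ * q)) / 2 = 0
    linear_combination (q * τ / 2) * h1'
  · change (q - (Real.cos η * t * (q * (B * τ)) - Real.sin η * q)) / 2 = 0
    linear_combination (-(q / 2 * Real.cos η * B)) * ht - q / 2 * h2'

/-! ### Weyl sequences of `D_η` -/

/-- A family of Weyl profiles concentrating at `s₀`, in the domain of `D_η`. -/
structure IsConcentratingFamily (Ω : Set ℂ) (η : ℂ → ℝ) (s₀ : ℂ) (φ : ℕ → ℂ → Spinor) : Prop where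
  contDiff : ∀ n, ContDiff ℝ 1 (φ n)
  hasCompactSupport : ∀ n, HasCompactSupport (φ n)
  boundary : ∀ n, ∀ s ∈ frontier Ω,
    Matrix.toEuclideanLin (projMinus (η s) (unitTangent Ω s)) (φ n s) = 0
  profile : ∀ n, IsWeylProfile Ω (n + 1) (φ n)
  support : ∀ n : ℕ, ∀ z ∈ Ω, 1 / ((n : ℝ) + 1) < ‖z - s₀‖ → φ n z = 0

namespace IsConcentratingFamily

variable {Ω : Set ℂ} {η : ℂ → ℝ} {s₀ : ℂ} {φ : ℕ → ℂ → Spinor}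

/-- The elements of the domain of `D_η` given by a concentrating family. -/
def toDomain (h : IsConcentratingFamily Ω η s₀ φ) (n : ℕ) : (diracOp Ω η).domain :=
  ⟨classL2 Ω (h.contDiff n).continuous (h.hasCompactSupport n),
    memDiracDomain_classL2 (h.contDiff n) (h.hasCompactSupport n) (h.boundary n)⟩

theorem norm_toDomain (h : IsConcentratingFamily Ω η s₀ φ) (n : ℕ) :
    ‖(h.toDomain n : L2 Ω)‖ = l2norm Ω (φ n) :=
  norm_classL2 _ (h.contDiff n).continuous (h.hasCompactSupport n)

theorem norm_toDomain_pos (h : IsConcentratingFamily Ω η s₀ φ) (n : ℕ) :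
    0 < ‖(h.toDomain n : L2 Ω)‖ := by
  rw [h.norm_toDomain]
  exact (h.profile n).1

theorem toDomain_ne_zero (h : IsConcentratingFamily Ω η s₀ φ) (n : ℕ) : h.toDomain n ≠ 0 := by
  intro h0
  have := h.norm_toDomain_pos n
  rw [h0] at this
  simp at this

theorem norm_diracOp_le (h : IsConcentratingFamily Ω η s₀ φ) (hop : IsOpen Ω) (n : ℕ) :
    ‖diracOp Ω η (h.toDomain n)‖ ≤ ‖(h.toDomain n : L2 Ω)‖ / (n + 1) := by
  have h1 : diracOp Ω η (h.toDomain n) = _ := diracOp_classL2 hop (h.contDiff n)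
    (h.hasCompactSupport n) (h.toDomain n).2
  rw [h1, norm_classL2, h.norm_toDomain]
  exact_mod_cast (h.profile n).2.1

/-- Weak convergence comes from the shrinking supports; after normalisation the residual is at most
`1 / (n + 1)`. -/
theorem isSingularWeylSequence (h : IsConcentratingFamily Ω η s₀ φ) (hop : IsOpen Ω) :
    IsSingularWeylSequence (diracOp Ω η) 0
      (fun n => ((‖(h.toDomain n : L2 Ω)‖ : ℂ)⁻¹) • h.toDomain n) := by
  have hnorm : ∀ n, ‖(((‖(h.toDomain n : L2 Ω)‖ : ℂ)⁻¹ • h.toDomain n : (diracOp Ω η).domain) :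
      L2 Ω)‖ = 1 := by
    intro n
    rw [Submodule.coe_smul, norm_smul, norm_inv, Complex.norm_real, norm_norm,
      inv_mul_cancel₀ (h.norm_toDomain_pos n).ne']
  refine ⟨hnorm, fun w => ?_, ?_⟩
  · refine tendsto_inner_zero_of_support tendsto_one_div_add_atTop_nhds_zero_nat
      (s₀ := s₀) (fun n => (hnorm n).le) (fun n => ?_) w
    filter_upwards [coeFn_classL2 Ω (h.contDiff n).continuous (h.hasCompactSupport n),
      Lp.coeFn_smul ((‖(h.toDomain n : L2 Ω)‖ : ℂ)⁻¹) (h.toDomain n : L2 Ω),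
      ae_restrict_mem hop.measurableSet] with z h1 h2 h3 h4
    rw [Submodule.coe_smul, h2, Pi.smul_apply]
    rw [Metric.mem_closedBall, dist_eq_norm, not_le] at h4
    rw [show (h.toDomain n : L2 Ω) z = φ n z from h1, h.support n z h3 h4, smul_zero]
  · refine squeeze_zero (fun _ => norm_nonneg _) (fun n => ?_)
      tendsto_one_div_add_atTop_nhds_zero_nat
    rw [zero_smul, sub_zero, LinearPMap.map_smul, norm_smul, norm_inv, Complex.norm_real, norm_norm,
      inv_mul_le_iff₀ (h.norm_toDomain_pos n), mul_one_div]
    exact h.norm_diracOp_le hop n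

theorem zero_mem_essentialSpectrum (h : IsConcentratingFamily Ω η s₀ φ) (hop : IsOpen Ω)
    {A : L2 Ω →ₗ.[ℂ] L2 Ω} (hA : IsSelfAdjointRealisation Ω η A) :
    (0 : ℂ) ∈ essentialSpectrum A :=
  ((h.isSingularWeylSequence hop).of_le hA.2).zero_mem_essentialSpectrum hA.1.isClosed

/-- A self-adjoint operator is closed, so a domain inside `H¹` would give a uniform bound of `∂₁` by
the graph norm. The profiles have graph norm equal to their `L²` norm, but derivatives growing with
the order of the pole. -/
theorem not_domain_le_H1 (h : IsConcentratingFamily Ω η s₀ φ) (hop : IsOpen Ω)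
    {A : L2 Ω →ₗ.[ℂ] L2 Ω} (hA : IsSelfAdjointRealisation Ω η A) :
    ¬ ∀ u ∈ A.domain, MemH1 Ω u := by
  intro hH1
  obtain ⟨c, hc⟩ := exists_weakDeriv_bound hop hA.1.isClosed fun u hu => (hH1 u hu).1
  obtain ⟨n, hn⟩ := exists_nat_gt (8 * c)
  have h1 := hc ⟨h.toDomain n, hA.2.1 (h.toDomain n).2⟩ _
    (hasWeakDeriv_classL2 Ω (h.contDiff n) (h.hasCompactSupport n) 1)
  rw [← hA.2.2 (x := h.toDomain n) rfl, norm_classL2] at h1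
  have hpos := h.norm_toDomain_pos n
  have h2 : ‖diracOp Ω η (h.toDomain n)‖ ≤ ‖(h.toDomain n : L2 Ω)‖ := by
    refine (h.norm_diracOp_le hop n).trans (div_le_self hpos.le ?_)
    linarith [(Nat.cast_nonneg n : (0 : ℝ) ≤ n)]
  rw [max_eq_left h2] at h1
  have h3 := (h.profile n).2.2
  rw [← h.norm_toDomain] at h3
  push_cast at h3
  have h4 : ((n : ℝ) + 1) * ‖(h.toDomain n : L2 Ω)‖ ≤ 8 * c * ‖(h.toDomain n : L2 Ω)‖ := by
    linarith
  have h5 := le_of_mul_le_mul_right h4 hpos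
  linarith

end IsConcentratingFamily

/-! ### Construction of concentrating families -/

theorem exists_isCutoff : ∃ χ : ℝ → ℝ, IsCutoff χ := by
  refine ⟨fun x => Real.smoothTransition (2 - 2 * x), ?_, fun x => ?_, fun x hx => ?_, fun x hx => ?_⟩
  · exact Real.smoothTransition.contDiff.comp (contDiff_const.sub (contDiff_const.mul contDiff_id))
  · exact ⟨Real.smoothTransition.nonneg _, Real.smoothTransition.le_one _⟩
  · exact Real.smoothTransition.one_of_one_le (by linarith)
  · exact Real.smoothTransition.zero_of_nonpos (by linarith)

theorem weylScalar_eq_zero {χ : ℝ → ℝ} (hχ : IsCutoff χ) {s₀ c z : ℂ} {R : ℝ} (hR : 0 < R) (m : ℕ)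
    (hz : R ≤ ‖z - s₀‖) : weylScalar χ s₀ c R m z = 0 := by
  rw [weylScalar, hχ.2.2.2 _ ((one_le_div hR).2 hz), Complex.ofReal_zero, zero_mul]

/-- The Weyl profiles `(f, f F)` at all orders, with supports shrinking to `s₀`. -/
theorem exists_profiles {Ω : Set ℂ} (hop : IsOpen Ω) (hbdd : Bornology.IsBounded Ω)
    (hC2 : HasC2Boundary Ω) {s₀ : ℂ} (hs₀ : s₀ ∈ frontier Ω) {R₀ : ℝ} (hR₀ : 0 < R₀) {B : ℂ → ℝ}
    {t : ℂ → ℂ} (hB : ContDiff ℝ 1 B) (ht : ContDiff ℝ 1 t) (hB' : HasFDerivAt B (0 : ℂ →L[ℝ] ℝ) s₀)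
    (hB0 : B s₀ = 0) {χ : ℝ → ℝ} (hχ : IsCutoff χ) :
    ∃ (R ε : ℕ → ℝ) (f : ℕ → ℂ → ℂ), (∀ n, 0 < R n ∧ R n ≤ R₀ ∧ 0 < ε n) ∧
      (∀ n : ℕ, R n ≤ 1 / ((n : ℝ) + 1)) ∧
      (∀ n, ContDiff ℝ 1 (f n)) ∧ (∀ n, HasCompactSupport (f n)) ∧
      (∀ n, ∀ z ∈ closure Ω,
        f n z = weylScalar χ s₀ (s₀ + ε n * outwardNormal Ω s₀) (R n) (n + 1) z) ∧
      ∀ n, IsWeylProfile Ω (n + 1) fun z => !₂[f n z, f n z * (B z * t z)] := by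
  have hν : IsOutwardNormal Ω s₀ (outwardNormal Ω s₀) := by
    rw [outwardNormal, dif_pos (hC2 s₀ hs₀)]
    exact (hC2 s₀ hs₀).choose_spec
  have hF : ContDiff ℝ 1 fun z => (B z : ℂ) * t z := (Complex.ofRealCLM.contDiff.comp hB).mul ht
  have hF' : HasFDerivAt (fun z => (B z : ℂ) * t z) (0 : ℂ →L[ℝ] ℂ) s₀ := by
    have h1 : HasFDerivAt (fun z => (B z : ℂ)) (Complex.ofRealCLM.comp (0 : ℂ →L[ℝ] ℝ)) s₀ :=
      Complex.ofRealCLM.hasFDerivAt.comp s₀ hB'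
    have h2 := h1.fun_mul (ht.differentiable (by simp) s₀).hasFDerivAt
    simpa [hB0] using h2
  -- The bound `1 / (n + 1)` on the radius makes the supports shrink; indices start at `0`, so the
  -- pole has order `n + 1 ≥ 1`.
  have key := fun n : ℕ => exists_isWeylProfile hop hbdd.measure_lt_top.ne hν hF (by simp [hB0]) hF'
    hχ (R₁ := min R₀ (1 / ((n : ℝ) + 1))) (by positivity) (Nat.le_add_left 1 n)
  choose R ε f hR hR₁ hε hf hfc hfw hprof using key
  exact ⟨R, ε, f, fun n => ⟨hR n, (hR₁ n).trans (min_le_left _ _), hε n⟩,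
    fun n => (hR₁ n).trans (min_le_right _ _), hf, hfc, hfw, hprof⟩

theorem hasCompactSupport_spinor {f g : ℂ → ℂ} (hf : HasCompactSupport f) (hg : HasCompactSupport g) :
    HasCompactSupport fun z => (!₂[f z, g z] : Spinor) := by
  rw [funext fun z => spinor_eq_smul_add (f z) (g z)]
  exact hf.smul_right.add hg.smul_right

section Families

variable {Ω : Set ℂ} {η : ℂ → ℝ} {s₀ : ℂ} {R₀ : ℝ} {B : ℂ → ℝ} {t : ℂ → ℂ} {χ : ℝ → ℝ}
  {R : ℕ → ℝ} {c : ℕ → ℂ} {f : ℕ → ℂ → ℂ}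

theorem isConcentratingFamily_of_profiles (hC2 : HasC2Boundary Ω) (hB : ContDiff ℝ 1 B)
    (ht : ContDiff ℝ 1 t)
    (hdata : ∀ s ∈ frontier Ω ∩ Metric.ball s₀ R₀, 0 < 1 + Real.sin (η s) ∧
      B s = Real.cos (η s) / (1 + Real.sin (η s)) ∧ t s = unitTangent Ω s)
    (hχ : IsCutoff χ) (hR : ∀ n, 0 < R n ∧ R n ≤ R₀) (hRn : ∀ n : ℕ, R n ≤ 1 / ((n : ℝ) + 1))
    (hf : ∀ n, ContDiff ℝ 1 (f n)) (hfc : ∀ n, HasCompactSupport (f n))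
    (hfw : ∀ n, ∀ z ∈ closure Ω, f n z = weylScalar χ s₀ (c n) (R n) (n + 1) z)
    (hprof : ∀ n, IsWeylProfile Ω (n + 1) fun z => !₂[f n z, f n z * (B z * t z)]) :
    IsConcentratingFamily Ω η s₀ fun n z => !₂[f n z, f n z * (B z * t z)] where
  contDiff n := contDiff_spinor (hf n)
    ((hf n).mul ((Complex.ofRealCLM.contDiff.comp hB).mul ht))
  hasCompactSupport n := hasCompactSupport_spinor (hfc n) (hfc n).mul_right
  boundary n s hs := by
    -- The boundary data are controlled only within `R₀` of `s₀`; farther out the cut-off makes the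
    -- spinor vanish, because `R n ≤ R₀`.
    by_cases hsR : s ∈ Metric.ball s₀ R₀
    · obtain ⟨h1, h2, h3⟩ := hdata s ⟨hs, hsR⟩
      rw [h3]
      exact projMinus_eq_zero (norm_unitTangent hC2 hs) h1 h2 _
    · rw [Metric.mem_ball, dist_eq_norm, not_lt] at hsR
      rw [hfw n s (frontier_subset_closure hs),
        weylScalar_eq_zero hχ (hR n).1 _ ((hR n).2.trans hsR), projMinus_spinor]
      ext i
      fin_cases i <;> simp
  profile := hprof
  support n z hz hzn := by
    rw [hfw n z (subset_closure hz), weylScalar_eq_zero hχ (hR n).1 _ ((hRn n).trans hzn.le)]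
    ext i
    fin_cases i <;> simp

theorem isConcentratingFamily_conj_of_profiles (hC2 : HasC2Boundary Ω) (hB : ContDiff ℝ 1 B)
    (ht : ContDiff ℝ 1 t)
    (hdata : ∀ s ∈ frontier Ω ∩ Metric.ball s₀ R₀, 0 < 1 + Real.sin (-η s) ∧
      B s = Real.cos (-η s) / (1 + Real.sin (-η s)) ∧ t s = unitTangent Ω s)
    (hχ : IsCutoff χ) (hR : ∀ n, 0 < R n ∧ R n ≤ R₀) (hRn : ∀ n : ℕ, R n ≤ 1 / ((n : ℝ) + 1))
    (hf : ∀ n, ContDiff ℝ 1 (f n)) (hfc : ∀ n, HasCompactSupport (f n))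
    (hfw : ∀ n, ∀ z ∈ closure Ω, f n z = weylScalar χ s₀ (c n) (R n) (n + 1) z)
    (hprof : ∀ n, IsWeylProfile Ω (n + 1) fun z => !₂[f n z, f n z * (B z * t z)]) :
    IsConcentratingFamily Ω η s₀
      fun n z => !₂[starRingEnd ℂ (f n z * (B z * t z)), starRingEnd ℂ (f n z)] where
  contDiff n := contDiff_spinor
    (Complex.conjCLE.contDiff.comp ((hf n).mul ((Complex.ofRealCLM.contDiff.comp hB).mul ht)))
    (Complex.conjCLE.contDiff.comp (hf n))
  hasCompactSupport n := hasCompactSupport_spinor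
    ((hfc n).mul_right.comp_left (g := starRingEnd ℂ) (map_zero _))
    ((hfc n).comp_left (g := starRingEnd ℂ) (map_zero _))
  boundary n s hs := by
    by_cases hsR : s ∈ Metric.ball s₀ R₀
    · obtain ⟨h1, h2, h3⟩ := hdata s ⟨hs, hsR⟩
      rw [h3]
      exact projMinus_conj_eq_zero (norm_unitTangent hC2 hs) h1 h2 _
    · rw [Metric.mem_ball, dist_eq_norm, not_lt] at hsR
      rw [hfw n s (frontier_subset_closure hs),
        weylScalar_eq_zero hχ (hR n).1 _ ((hR n).2.trans hsR), projMinus_spinor]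
      ext i
      fin_cases i <;> simp
  profile n := (hprof n).conj (hf n) ((hf n).mul ((Complex.ofRealCLM.contDiff.comp hB).mul ht))
  support n z hz hzn := by
    rw [hfw n z (subset_closure hz), weylScalar_eq_zero hχ (hR n).1 _ ((hRn n).trans hzn.le)]
    ext i
    fin_cases i <;> simp

end Families

theorem exists_isConcentratingFamily {Ω : Set ℂ} (hop : IsOpen Ω) (hbdd : Bornology.IsBounded Ω)
    (hC2 : HasC2Boundary Ω) {η : ℂ → ℝ} {s₀ : ℂ} (hs₀ : s₀ ∈ frontier Ω)
    (hη : ∃ η' : ℂ → ℝ, ContDiffAt ℝ 1 η' s₀ ∧ η =ᶠ[𝓝[frontier Ω] s₀] η')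
    (hcos : (fun s => Real.cos (η s)) =O[𝓝[frontier Ω] s₀] fun s => ‖s - s₀‖ ^ 2) :
    ∃ φ, IsConcentratingFamily Ω η s₀ φ := by
  have hcos0 : Real.cos (η s₀) = 0 := hcos.eq_zero_of_norm_pow_within hs₀ (by norm_num)
  obtain ⟨χ, hχ⟩ := exists_isCutoff
  have hsin : Real.sin (η s₀) = 1 ∨ Real.sin (η s₀) = -1 := by
    refine mul_self_eq_one_iff.1 ?_
    have := Real.sin_sq_add_cos_sq (η s₀)
    rw [hcos0] at this
    linarith
  rcases hsin with hsin | hsin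
  · obtain ⟨R₀, B, t, hR₀, hB, ht, hdata, hB', hB0⟩ :=
      exists_boundary_extension hop hC2 hs₀ hη hcos hsin
    obtain ⟨R, ε, f, hR, hRn, hf, hfc, hfw, hprof⟩ :=
      exists_profiles hop hbdd hC2 hs₀ hR₀ hB ht hB' hB0 hχ
    exact ⟨_, isConcentratingFamily_of_profiles hC2 hB ht hdata hχ
      (fun n => ⟨(hR n).1, (hR n).2.1⟩) hRn hf hfc hfw hprof⟩
  -- For `sin η(s₀) = -1` the extension is built for `-η`, and the resulting profiles are
  -- charge-conjugated.
  · obtain ⟨η', hη', heq⟩ := hη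
    obtain ⟨R₀, B, t, hR₀, hB, ht, hdata, hB', hB0⟩ :=
      exists_boundary_extension (η := fun s => -η s) hop hC2 hs₀ ⟨fun s => -η' s, hη'.neg, heq.neg⟩
        (by simpa only [Real.cos_neg] using hcos) (by rw [Real.sin_neg, hsin, neg_neg])
    obtain ⟨R, ε, f, hR, hRn, hf, hfc, hfw, hprof⟩ :=
      exists_profiles hop hbdd hC2 hs₀ hR₀ hB ht hB' hB0 hχ
    exact ⟨_, isConcentratingFamily_conj_of_profiles hC2 hB ht hdata hχ
      (fun n => ⟨(hR n).1, (hR n).2.1⟩) hRn hf hfc hfw hprof⟩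

end DiracBilliard

end

/-! ### The theorem -/

theorem mainTheorem2 (Ω : Set ℂ) (hΩ_open : IsOpen Ω) (hΩ_bdd : Bornology.IsBounded Ω)
    (hΩ_C2 : DiracBilliard.HasC2Boundary Ω) (η : ℂ → ℝ) (s₀ : ℂ) (hs₀ : s₀ ∈ frontier Ω)
    (hη : ∃ η' : ℂ → ℝ, ContDiffAt ℝ 1 η' s₀ ∧ η =ᶠ[𝓝[frontier Ω] s₀] η')
    (hcos : (fun s => Real.cos (η s)) =O[𝓝[frontier Ω] s₀] fun s => ‖s - s₀‖ ^ 2) :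
    (Real.sin (η s₀) = 1 →
      ∃ (R₀ : ℝ) (B : ℂ → ℝ) (t : ℂ → ℂ), 0 < R₀ ∧ ContDiff ℝ 1 B ∧ ContDiff ℝ 1 t ∧
        (∀ s ∈ frontier Ω ∩ Metric.ball s₀ R₀,
          0 < 1 + Real.sin (η s) ∧ B s = Real.cos (η s) / (1 + Real.sin (η s)) ∧
            t s = DiracBilliard.unitTangent Ω s) ∧
        ∀ χ : ℝ → ℝ, DiracBilliard.IsCutoff χ →
          ∃ (R ε : ℕ → ℝ) (v : ℕ → (DiracBilliard.diracOp Ω η).domain),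
            (∀ n, 0 < R n ∧ R n ≤ R₀ ∧ 0 < ε n) ∧
            (∀ n, ∀ᵐ z ∂(volume.restrict Ω), (v n : DiracBilliard.L2 Ω) z =
              DiracBilliard.weylFun χ B t s₀ (s₀ + ε n * DiracBilliard.outwardNormal Ω s₀)
                (R n) (n + 1) z) ∧
            (∀ n, v n ≠ 0 ∧ ‖DiracBilliard.diracOp Ω η (v n)‖ ≤
              ‖(v n : DiracBilliard.L2 Ω)‖ / (n + 1)) ∧
            DiracBilliard.IsSingularWeylSequence (DiracBilliard.diracOp Ω η) 0
              (fun n => ((‖(v n : DiracBilliard.L2 Ω)‖ : ℂ)⁻¹) • v n)) ∧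
    (∃ v : ℕ → (DiracBilliard.diracOp Ω η).domain,
      DiracBilliard.IsSingularWeylSequence (DiracBilliard.diracOp Ω η) 0 v) ∧
    (∀ A : DiracBilliard.L2 Ω →ₗ.[ℂ] DiracBilliard.L2 Ω,
      DiracBilliard.IsSelfAdjointRealisation Ω η A →
        (0 : ℂ) ∈ DiracBilliard.essentialSpectrum A ∧
        ¬ ∀ u ∈ A.domain, DiracBilliard.MemH1 Ω u) := by
  refine ⟨fun hsin => ?_, ?_, ?_⟩
  · obtain ⟨R₀, B, t, hR₀, hB, ht, hdata, hB', hB0⟩ :=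
      DiracBilliard.exists_boundary_extension hΩ_open hΩ_C2 hs₀ hη hcos hsin
    refine ⟨R₀, B, t, hR₀, hB, ht, hdata, fun χ hχ => ?_⟩
    obtain ⟨R, ε, f, hR, hRn, hf, hfc, hfw, hprof⟩ :=
      DiracBilliard.exists_profiles hΩ_open hΩ_bdd hΩ_C2 hs₀ hR₀ hB ht hB' hB0 hχ
    have hfam := DiracBilliard.isConcentratingFamily_of_profiles hΩ_C2 hB ht hdata hχ
      (fun n => ⟨(hR n).1, (hR n).2.1⟩) hRn hf hfc hfw hprof
    -- The removal of the pole took place away from `closure Ω`, so on `Ω` the class in `L²` is that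
    -- of the explicit function.
    refine ⟨R, ε, hfam.toDomain, hR, fun n => ?_,
      fun n => ⟨hfam.toDomain_ne_zero n, hfam.norm_diracOp_le hΩ_open n⟩,
      hfam.isSingularWeylSequence hΩ_open⟩
    filter_upwards [DiracBilliard.coeFn_classL2 Ω (hfam.contDiff n).continuous
      (hfam.hasCompactSupport n), ae_restrict_mem hΩ_open.measurableSet] with z h1 h2
    refine h1.trans ?_
    rw [hfw n z (subset_closure h2)]
    ext i
    fin_cases i <;> simp [DiracBilliard.weylFun, DiracBilliard.weylScalar]
  · obtain ⟨φ, hφ⟩ := DiracBilliard.exists_isConcentratingFamily hΩ_open hΩ_bdd hΩ_C2 hs₀ hη hcos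
    exact ⟨_, hφ.isSingularWeylSequence hΩ_open⟩
  · obtain ⟨φ, hφ⟩ := DiracBilliard.exists_isConcentratingFamily hΩ_open hΩ_bdd hΩ_C2 hs₀ hη hcos
    exact fun A hA => ⟨hφ.zero_mem_essentialSpectrum hΩ_open hA, hφ.not_domain_le_H1 hΩ_open hA⟩
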